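/- Notation. For $x\in\mathbb R$ let $[x]_\pm=\frac{|x|\pm x}{2}$. For $\nu\in\mathbb R$ put $p_F(\nu)=1+\frac2\nu$ if $\nu>0$ and $p_F(\nu)=+\infty$ if $\nu\le0$; $p_S(\nu)=\frac{\nu+1+\sqrt{\nu^2+10\nu-7}}{2(\nu-1)}$ if $\nu>1$ and $p_S(\nu)=+\infty$ if $\nu\le1$; $\gamma_F(p,\nu)=2-\nu(p-1)$; $\gamma_S(p,\nu)=2+(\nu+1)p-(\nu-1)p^2$. For an integer $n\ge1$ and $\mu\ge0$ put $\mu_*=\frac{n^2+n+2}{n+2}$ and $p_\mu(n)=\max\{p_F(n-[\mu-1]_-),\,p_S(n+\mu)\}$. Problem. For $\varepsilon>0$ consider $$u_{tt}-\Delta u+\frac{\mu}{1+t}u_t=|u|^p \ \text{ in } \mathbb R^n\times(0,T),\qquad u(x,0)=\varepsilon f(x),\quad u_t(x,0)=\varepsilon g(x).$$ An energy solution over $[0,T)$, $0<T\le\infty$, is a function $u\in C([0,T),H^1(\mathbb R^n))\cap C^1([0,T),L^2(\mathbb R^n))\cap C((0,T),L^p_{loc}(\mathbb R^n))$ that takes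 the initial data and satisfies, for all $\phi\in C_0^\infty(\mathbb R^n\times[0,T))$ and $t\in[0,T)$ (the time integral on the right being assumed to exist), $$\int u_t(x,t)\phi(x,t)\,dx-\int\varepsilon g(x)\phi(x,0)\,dx+\int_0^t\!\!\int\{-u_t\phi_t+\nabla u\cdot\nabla\phi\}\,dx\,ds+\int_0^t\!\!\int\frac{\mu}{1+s}u_t\phi\,dx\,ds=\int_0^t\!\!\int|u|^p\phi\,dx\,ds .$$ Theorem. Let $n\ge1$, $\mu\ge0$, $1<p<p_\mu(n)$ and $R\ge1$. Let $f\in H^1(\mathbb R^n)$ and $g\in L^2(\mathbb R^n)$ satisfy $f\ge0$ a.e., $f\not\equiv0$ (as an element of $L^2$), and $[\mu-1]_+f+g=0$ a.e. Let $T_\varepsilon$ be the lifespan, i.e. the supremum of all $T\in(0,\infty]$ for which there is an energy solution $u$ over $[0,T)$ with $\operatorname{supp}u\subset\{(x,t):|x|\le t+R\}$. Then there are constants $\varepsilon_3>0$ and $C>0$, depending only on $f,g,\mu,n,p,R$ (not on $\varepsilon$), such that for all $0<\varepsilon\le\varepsilon_3$: 1. if $0\le\mu\le\mu_*$, then $T_\varepsilon\le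 C\,\varepsilon^{-2p(p-1)/\gamma_S(p,n+\mu)}$; 2. if $\mu_*<\mu<n+3$, then with $p_*=1+\frac{n-\mu+3}{n+\mu-1}$: $T_\varepsilon\le C\,\varepsilon^{-2p(p-1)/\gamma_S(p,n+\mu)}$ if $1<p<p_*$; $T_\varepsilon\le C\,\sigma_0(\varepsilon)$ if $p=p_*$, where $\sigma_0=\sigma_0(\varepsilon)$ is the unique positive solution of $\varepsilon^p\,\sigma_0^{\frac2{p-1}-n}\ln(1+\sigma_0)=1$; $T_\varepsilon\le C\,\varepsilon^{-p(p-1)/\gamma_F(p,n)}$ if $p_*<p<p_\mu(n)$; 3. if $\mu\ge n+3$, then $T_\varepsilon\le C\,\varepsilon^{-p(p-1)/\gamma_F(p,n)}$; 4. if moreover $n=1$, $0<\mu<2$ and $1<p<\frac{2}{1+|\mu-1|}$, then also $T_\varepsilon\le C\,\varepsilon^{-(p-1)/\gamma_F(p,\,1+[\mu-1]_+)}$. -/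

import Mathlib

open MeasureTheory Filter Topology
open scoped ENNReal ContDiff

namespace DampedWave

noncomputable section

/-- The space `ℝⁿ` with its Euclidean norm. -/
abbrev Space (n : ℕ) : Type := EuclideanSpace ℝ (Fin n)

/-! ### Exponents -/

/-- The Fujita exponent `p_F(ν)`. -/
def fujitaExp (ν : ℝ) : EReal :=
  if 0 < ν then ((1 + 2 / ν : ℝ) : EReal) else ⊤

/-- The Strauss exponent `p_S(ν)`. -/
def straussExp (ν : ℝ) : EReal :=
  if 1 < ν then
    (((ν + 1 + Real.sqrt (ν ^ 2 + 10 * ν - 7)) / (2 * (ν - 1)) : ℝ) : EReal)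
  else ⊤

/-- `γ_F(p, ν) = 2 - ν (p - 1)`. -/
def gammaF (p ν : ℝ) : ℝ := 2 - ν * (p - 1)

/-- `γ_S(p, ν) = 2 + (ν + 1) p - (ν - 1) p²`. -/
def gammaS (p ν : ℝ) : ℝ := 2 + (ν + 1) * p - (ν - 1) * p ^ 2

/-- The threshold `μ_*(n) = (n² + n + 2) / (n + 2)`. -/
def muStar (n : ℕ) : ℝ := ((n : ℝ) ^ 2 + n + 2) / (n + 2)

/-- `p_μ(n) = max {p_F(n - [μ - 1]₋), p_S(n + μ)}`. -/
def critExp (n : ℕ) (μ : ℝ) : EReal :=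
  max (fujitaExp (n - (μ - 1)⁻)) (straussExp (n + μ))

/-- `p_* = 1 + (n - μ + 3) / (n + μ - 1)`; it is used only where `n + μ > 1`. -/
def pStar (n : ℕ) (μ : ℝ) : ℝ := 1 + (n - μ + 3) / (n + μ - 1)

/-- `s` is a positive solution of `ε ^ p * s ^ (2 / (p - 1) - n) * log (1 + s) = 1`. -/
def IsSigmaZero (n : ℕ) (p ε s : ℝ) : Prop :=
  0 < s ∧ ε ^ p * s ^ (2 / (p - 1) - n) * Real.log (1 + s) = 1

/-! ### Sobolev space `H¹(ℝⁿ)` -/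

/-- `G` is the weak gradient of `v` on `ℝⁿ` (both are meant to be locally integrable). -/
def HasWeakGradient {n : ℕ} (v : Space n → ℝ) (G : Space n → Space n) : Prop :=
  ∀ φ : Space n → ℝ, ContDiff ℝ ∞ φ → HasCompactSupport φ →
    ∫ x, v x • gradient φ x = - ∫ x, φ x • G x

/-- `v ∈ H¹(ℝⁿ)`: `v` is square integrable and has a square integrable weak gradient. -/
def MemH1 {n : ℕ} (v : Space n → ℝ) : Prop :=
  MemLp v 2 volume ∧ ∃ G : Space n → Space n, MemLp G 2 volume ∧ HasWeakGradient v G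

/-! ### Energy solutions -/

/-- The time interval `[0, T)`, with `T ∈ [0, ∞]`. -/
def timeInterval (T : ℝ≥0∞) : Set ℝ := {t : ℝ | 0 ≤ t ∧ ENNReal.ofReal t < T}

/-- Test functions in `C_0^∞(ℝⁿ × [0, T))`, given as restrictions of smooth compactly supported
functions on `ℝⁿ × (-∞, T)`. They need not vanish at time `0`. -/
structure IsTestFunction {n : ℕ} (T : ℝ≥0∞) (φ : Space n × ℝ → ℝ) : Prop where
  smooth : ContDiff ℝ ∞ φ
  compact_support : HasCompactSupport φ
  support_lt : ∀ z ∈ tsupport φ, ENNReal.ofReal z.2 < T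

/-- `u` is an energy solution over `[0, T)` of
`u_tt - Δ u + μ / (1 + t) u_t = |u|^p`, `u(x, 0) = ε f(x)`, `u_t(x, 0) = ε g(x)`.
The function `t ↦ u(t)` takes values in `L²(ℝⁿ)`; `v` is its time derivative, and `G` its spatial
gradient; on `[0, T)` both are determined by `u`. -/
structure IsEnergySolution {n : ℕ} (μ p ε : ℝ) (f g : Space n → ℝ) (T : ℝ≥0∞)
    (u v : ℝ → Lp ℝ 2 (volume : Measure (Space n)))
    (G : ℝ → Lp (Space n) 2 (volume : Measure (Space n))) : Prop where
  /-- the interval `[0, T)` is nonempty -/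
  T_pos : 0 < T
  /-- `u ∈ C([0, T), H¹)`: the weak gradient of `u(t)` is `G(t) ∈ L²`, and `u`, `G` are continuous
  with values in `L²` -/
  weak_gradient : ∀ t ∈ timeInterval T, HasWeakGradient (u t) (G t)
  continuous_u : ContinuousOn u (timeInterval T)
  continuous_grad : ContinuousOn G (timeInterval T)
  /-- `u ∈ C¹([0, T), L²)` with time derivative `v` -/
  hasDeriv : ∀ t ∈ timeInterval T, HasDerivWithinAt u (v t) (timeInterval T) t
  continuous_v : ContinuousOn v (timeInterval T)
  /-- `u ∈ C((0, T), L^p_loc)` -/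
  memLp_loc : ∀ t ∈ timeInterval T, 0 < t → ∀ K : Set (Space n), IsCompact K →
    MemLp (u t) (ENNReal.ofReal p) (volume.restrict K)
  continuous_Lp_loc : ∀ t ∈ timeInterval T, 0 < t → ∀ K : Set (Space n), IsCompact K →
    Tendsto (fun s => eLpNorm (fun x => u s x - u t x) (ENNReal.ofReal p) (volume.restrict K))
      (𝓝 t) (𝓝 0)
  /-- initial data -/
  initial_u : ∀ᵐ x, u 0 x = ε * f x
  initial_v : ∀ᵐ x, v 0 x = ε * g x
  /-- the time integral of the nonlinear term exists -/
  integrable_nonlinearity : ∀ φ : Space n × ℝ → ℝ, IsTestFunction T φ → ∀ t ∈ timeInterval T,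
    IntervalIntegrable (fun s => ∫ x, |u s x| ^ p * φ (x, s)) volume 0 t
  /-- the energy identity -/
  energy_identity : ∀ φ : Space n × ℝ → ℝ, IsTestFunction T φ → ∀ t ∈ timeInterval T,
    (∫ x, v t x * φ (x, t)) - (∫ x, ε * g x * φ (x, 0))
      + (∫ s in (0 : ℝ)..t, ∫ x,
          (-(v s x) * deriv (fun τ => φ (x, τ)) s
            + inner ℝ (G s x) (gradient (fun y => φ (y, s)) x)))
      + (∫ s in (0 : ℝ)..t, ∫ x, μ / (1 + s) * v s x * φ (x, s))
    = ∫ s in (0 : ℝ)..t, ∫ x, |u s x| ^ p * φ (x, s)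

/-- `supp u ⊆ {(x, t) : |x| ≤ t + R}` on `ℝⁿ × [0, T)`. -/
def SupportedInCone {n : ℕ} (R : ℝ) (T : ℝ≥0∞)
    (u : ℝ → Lp ℝ 2 (volume : Measure (Space n))) : Prop :=
  ∀ t ∈ timeInterval T, ∀ᵐ x, t + R < ‖x‖ → u t x = 0

/-- The lifespan (blow-up time) `T_ε ∈ [0, ∞]`: the supremum of all `T ∈ (0, ∞]` such that an
energy solution with support in the cone `|x| ≤ t + R` exists over `[0, T)`. -/
def lifespan {n : ℕ} (μ p R : ℝ) (f g : Space n → ℝ) (ε : ℝ) : ℝ≥0∞ :=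
  sSup {T : ℝ≥0∞ | ∃ u v G, IsEnergySolution μ p ε f g T u v G ∧ SupportedInCone R T u}

end

end DampedWave

namespace DampedWave

/-! ### Linear comparison for second order equations -/

/-! Test function method reduced to ordinary differential equations, in the time variable `s = 1 +
t`. If `Δψ = lψ` and `ψ ≥ 0`, the average `Y = ∫ uψ` solves `Y'' + (μ/s) Y' = lY + ∫ |u|^p ψ`. Write
`m = [μ - 1]₊`. The hypothesis on the data says `Y'(1) = -m Y(1)`, and since `m (m + 1 - μ) = 0` the
function `s^(-m)` solves the homogeneous equation for `l = 0` with exactly this initial ratio.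

Two weights are used. For `ψ = radialEigen`, a positive radial solution of `Δψ = ψ`, the average is
at least a constant times `ε s^(-μ/2) e^s` (`exists_weighted_lower`). Since `u` lives in the ball of
radius `s - 1 + R`, Hölder's inequality and the growth of `∫ ψ^(p/(p-1))`
(`exists_integral_radialEigen_le`) turn this into `∫ |u|^p ≥ c₁ ε^p s^(n-1-(n+μ-1)p/2)`. For `ψ = 1`
the average is the mass `Y`, and Hölder gives `∫ |u|^p ≥ c₀ s^(-n(p-1)) Y^p` (`exists_mass_bounds`).

The second inequality forces blow-up on one dyadic window: if `Y ≥ A` on `[S, 2S]` and the solution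
lives that long, then `A^(p-1) S^(2-n(p-1)) ≤ K` (`MassODE.exists_blowup_bound`). Each lifespan
bound comes from one choice of `A`: `ε^p S^(n+1-(n+μ-1)p/2)`, integrating the first inequality
twice, gives `γ_S/2`; `ε^p`, from the nonnegative derivative of `Y - εI s^(-m)`, where `Y(1) = εI`,
gives `γ_F(p,n)`; `ε^p log S`, when the first inequality has exponent exactly `-2`, i.e. `p = p_*`,
gives `σ₀`; `ε S^(-m)`, the linear part alone, gives `γ_F(p,1+m)` for `n = 1`.

The remaining algebra shows that the relevant `γ` is positive in each range. It rests on the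
identity `γ_S(p,n+μ) = 2γ_F(p,n) + (p-1)((n-μ+3) - (n+μ-1)(p-1))`, whose last bracket changes sign
at `p_*` if `n + μ > 1`. -/

lemma monotoneOn_of_hasDerivAt {f f' : ℝ → ℝ} {a b : ℝ} (hc : ContinuousOn f (Set.Icc a b))
    (hd : ∀ x ∈ Set.Ioo a b, HasDerivAt f (f' x) x) (h0 : ∀ x ∈ Set.Ioo a b, 0 ≤ f' x) :
    MonotoneOn f (Set.Icc a b) := by
  apply monotoneOn_of_deriv_nonneg (convex_Icc a b) hc
  · rw [interior_Icc]
    exact fun x hx => (hd x hx).differentiableAt.differentiableWithinAt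
  · rw [interior_Icc]
    intro x hx
    rw [(hd x hx).deriv]
    exact h0 x hx

/-- `Y'' + (μ / s) Y' = l Y + r` on `(1, b)` with `Y' = Z` and `0 ≤ r`. -/
structure DampedODE (μ l b : ℝ) (Y Z r : ℝ → ℝ) : Prop where
  cont : ContinuousOn Y (Set.Icc 1 b)
  cont_deriv : ContinuousOn Z (Set.Icc 1 b)
  hasDerivAt : ∀ s ∈ Set.Ioo 1 b, HasDerivAt Y (Z s) s
  hasDerivAt_deriv : ∀ s ∈ Set.Ioo 1 b, HasDerivAt Z (l * Y s + r s - μ / s * Z s) s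
  nonneg : ∀ s ∈ Set.Ioo 1 b, 0 ≤ r s

namespace DampedODE

variable {μ l b : ℝ} {Y Z r : ℝ → ℝ}

lemma mono (h : DampedODE μ l b Y Z r) {b' : ℝ} (hb : b' ≤ b) : DampedODE μ l b' Y Z r where
  cont := h.cont.mono (Set.Icc_subset_Icc_right hb)
  cont_deriv := h.cont_deriv.mono (Set.Icc_subset_Icc_right hb)
  hasDerivAt s hs := h.hasDerivAt s ⟨hs.1, hs.2.trans_le hb⟩
  hasDerivAt_deriv s hs := h.hasDerivAt_deriv s ⟨hs.1, hs.2.trans_le hb⟩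
  nonneg s hs := h.nonneg s ⟨hs.1, hs.2.trans_le hb⟩

lemma continuousOn_rpow_mul (c : ℝ) {a b : ℝ} (ha : 0 < a) {f : ℝ → ℝ}
    (hf : ContinuousOn f (Set.Icc a b)) : ContinuousOn (fun s => s ^ c * f s) (Set.Icc a b) :=
  (continuousOn_id.rpow_const fun _ hx => Or.inl (ha.trans_le hx.1).ne').mul hf

/-- `(s ^ μ Z)' = s ^ μ (l Y + r)`. -/
lemma hasDerivAt_weight (h : DampedODE μ l b Y Z r) {s : ℝ} (hs : s ∈ Set.Ioo 1 b) :
    HasDerivAt (fun s => s ^ μ * Z s) (s ^ μ * (l * Y s + r s)) s := by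
  have hs0 : 0 < s := one_pos.trans hs.1
  refine ((Real.hasDerivAt_rpow_const (p := μ) (Or.inl hs0.ne')).fun_mul
    (h.hasDerivAt_deriv s hs)).congr_deriv ?_
  rw [Real.rpow_sub_one hs0.ne']
  field_simp
  ring

/-- Where `l Y` is nonnegative, so is the derivative, if it is so initially. -/
lemma deriv_nonneg (h : DampedODE μ l b Y Z r) (h1 : 0 ≤ Z 1)
    (hl : ∀ s ∈ Set.Ioo 1 b, 0 ≤ l * Y s) : ∀ s ∈ Set.Icc 1 b, 0 ≤ Z s := by
  intro s hs
  have hm := monotoneOn_of_hasDerivAt (continuousOn_rpow_mul μ one_pos h.cont_deriv)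
    (fun x hx => h.hasDerivAt_weight hx)
    (fun x hx => mul_nonneg (Real.rpow_nonneg (one_pos.trans hx.1).le _)
      (add_nonneg (hl x hx) (h.nonneg x hx)))
  have := hm (Set.left_mem_Icc.2 (hs.1.trans hs.2)) hs hs.1
  simp only [Real.one_rpow, one_mul] at this
  exact nonneg_of_mul_nonneg_right (h1.trans this) (Real.rpow_pos_of_pos (one_pos.trans_le hs.1) _)

lemma monotoneOn (h : DampedODE μ l b Y Z r) (h1 : 0 ≤ Z 1)
    (hl : ∀ s ∈ Set.Ioo 1 b, 0 ≤ l * Y s) : MonotoneOn Y (Set.Icc 1 b) :=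
  monotoneOn_of_hasDerivAt h.cont h.hasDerivAt
    fun s hs => h.deriv_nonneg h1 hl s (Set.Ioo_subset_Icc_self hs)

/-- A solution with positive initial value and nonnegative initial derivative stays above its
initial value. -/
lemma initial_le (h : DampedODE μ l b Y Z r) (hl : 0 ≤ l) (hY : 0 < Y 1) (hZ : 0 ≤ Z 1) :
    ∀ s ∈ Set.Icc 1 b, Y 1 ≤ Y s := by
  -- Bootstrap: up to the first point `y` where `Y` has dropped to half its initial value, `Y` is
  -- nonnegative, hence nondecreasing on `[1, y]`, which contradicts the drop.
  have key : ∀ s ∈ Set.Icc 1 b, Y 1 / 2 < Y s := by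
    by_contra! hcon
    obtain ⟨x, hx, hYx⟩ := hcon
    have hcl : IsCompact (Set.Icc 1 b ∩ Y ⁻¹' Set.Iic (Y 1 / 2)) :=
      isCompact_Icc.of_isClosed_subset (h.cont.preimage_isClosed_of_isClosed isClosed_Icc
        isClosed_Iic) Set.inter_subset_left
    obtain ⟨y, ⟨hy, hYy⟩, hleast⟩ := hcl.exists_isLeast ⟨x, hx, hYx⟩
    have hpos : ∀ s ∈ Set.Ioo 1 y, 0 ≤ l * Y s := by
      intro s hs
      refine mul_nonneg hl ?_
      by_contra! hneg
      have : y ≤ s := hleast ⟨⟨hs.1.le, hs.2.le.trans hy.2⟩, show Y s ≤ Y 1 / 2 by linarith⟩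
      linarith [hs.2]
    have := (h.mono hy.2).monotoneOn hZ hpos (Set.left_mem_Icc.2 hy.1) (Set.right_mem_Icc.2 hy.1)
      hy.1
    have hYy' : Y y ≤ Y 1 / 2 := hYy
    linarith
  intro s hs
  exact h.monotoneOn hZ (fun x hx => mul_nonneg hl
    (by linarith [key x (Set.Ioo_subset_Icc_self hx)])) (Set.left_mem_Icc.2 (hs.1.trans hs.2)) hs hs.1

end DampedODE

/-! ### Exponential growth of solutions of `Y'' + (κ/s) Y' = Y` -/

/-- Approximate diagonalisation of the system for `(Y, Y')`. The combination follows the growing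
mode `s^(-κ/2) e^s`: its logarithmic rate is `1 - κ/(2s)`, up to errors of size `(|Y| + |Y'|)/s²`
and a source term. -/
lemma hasDerivAt_growth_functional {κ y z w s : ℝ} {Y Z : ℝ → ℝ} (hs : 0 < s)
    (hY : HasDerivAt Y z s) (hZ : HasDerivAt Z (y + w - κ / s * z) s) (ey : Y s = y)
    (ez : Z s = z) :
    HasDerivAt (fun s => (1 - κ / (4 * s)) * Z s + (1 + κ / (4 * s)) * Y s)
      ((1 - κ / (2 * s)) * ((1 - κ / (4 * s)) * z + (1 + κ / (4 * s)) * y)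
        + ((κ / 4 + κ ^ 2 / 8) * z + (- κ / 4 + κ ^ 2 / 8) * y) / s ^ 2
        + (1 - κ / (4 * s)) * w) s := by
  have h4 : HasDerivAt (fun s : ℝ => κ / (4 * s)) (- κ / (4 * s ^ 2)) s := by
    have := ((hasDerivAt_inv hs.ne').const_mul (κ / 4)).congr_deriv
      (show κ / 4 * (-(s ^ 2)⁻¹) = - κ / (4 * s ^ 2) by field_simp)
    refine this.congr_of_eventuallyEq (Eventually.of_forall fun x => ?_)
    simp only [div_eq_mul_inv, mul_inv]
    ring
  refine (((h4.const_sub 1).fun_mul hZ).fun_add ((h4.const_add 1).fun_mul hY)).congr_deriv ?_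
  rw [ey, ez]
  field_simp
  ring

/-- Integrating factor for the rate `1 - κ/(2s)`. The extra `exp(-C/s)`, harmless away from `0`,
contributes `C/s²`, which absorbs the errors of the growth functional; the sign of `C` selects a
lower or an upper bound. -/
lemma hasDerivAt_growth_weight (κ C : ℝ) {s : ℝ} (hs : 0 < s) :
    HasDerivAt (fun s => s ^ (κ / 2) * (Real.exp (-s) * Real.exp (-C / s)))
      ((κ / (2 * s) - 1 + C / s ^ 2) * (s ^ (κ / 2) * (Real.exp (-s) * Real.exp (-C / s)))) s := by
  have h4 : HasDerivAt (fun s : ℝ => - C / s) (C / s ^ 2) s := by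
    refine ((hasDerivAt_inv hs.ne').const_mul (-C)).congr_deriv ?_
    field_simp
  refine ((Real.hasDerivAt_rpow_const (p := κ / 2) (Or.inl hs.ne')).fun_mul
    ((hasDerivAt_neg s).exp.fun_mul h4.exp)).congr_deriv ?_
  rw [Real.rpow_sub_one hs.ne']
  field_simp
  ring

/-- Solutions of `Y'' + (κ / s) Y' ≥ Y` with nonnegative initial derivative grow at least like
`s ^ (-κ / 2) e ^ s`. -/
theorem exists_growth_lower (κ : ℝ) : ∃ c : ℝ, 0 < c ∧ ∀ (b : ℝ) (Y Z r : ℝ → ℝ),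
    DampedODE κ 1 b Y Z r → 0 < Y 1 → 0 ≤ Z 1 → ∀ s ∈ Set.Icc 1 b,
      c * Y 1 * (s ^ (-(κ / 2)) * Real.exp s) ≤ Y s := by
  -- Beyond `s₀` one has `|κ/(4s)| ≤ 1/2`, so the growth functional is comparable with `Y + Y'`.
  set s₀ : ℝ := max 1 (|κ| / 2) with hs₀
  have hs₀1 : 1 ≤ s₀ := le_max_left _ _
  have hs₀p : 0 < s₀ := one_pos.trans_le hs₀1
  set W : ℝ → ℝ := fun s => s ^ (κ / 2) * (Real.exp (-s) * Real.exp (-(|κ| / 2) / s)) with hW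
  have hWpos : ∀ s, 0 < s → 0 < W s := fun s hs => by
    simp only [hW]; have := Real.rpow_pos_of_pos hs (κ / 2); positivity
  set M : ℝ := s₀ ^ (|κ| / 2) * Real.exp s₀ with hM
  have hMpos : 0 < M := by have := Real.rpow_pos_of_pos hs₀p (|κ| / 2); positivity
  have hcpos : 0 < min (1 / M) (W s₀ / (3 * (2 + |κ| / 2))) := by
    have := hWpos s₀ hs₀p
    have := abs_nonneg κ
    exact lt_min (by positivity) (by positivity)
  -- The first entry of the minimum settles `s ≤ s₀`, where `Y ≥ Y(1)` suffices; the second is what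
  -- the comparison beyond `s₀` needs.
  obtain ⟨c, hc⟩ : ∃ c, c = min (1 / M) (W s₀ / (3 * (2 + |κ| / 2))) := ⟨_, rfl⟩
  rw [← hc] at hcpos
  have hcM : c * M ≤ 1 := by
    rw [← le_div_iff₀ hMpos, hc]; exact min_le_left _ _
  have hcW : c * (3 * (2 + |κ| / 2)) ≤ W s₀ := by
    rw [← le_div_iff₀ (by have := abs_nonneg κ; positivity), hc]; exact min_le_right _ _
  refine ⟨c, hcpos, ?_⟩
  intro b Y Z r h hY1 hZ1
  have hYge := h.initial_le zero_le_one hY1 hZ1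
  have hZge := h.deriv_nonneg hZ1 (fun s hs => by
    have := hYge s (Set.Ioo_subset_Icc_self hs); linarith)
  have small : ∀ s ∈ Set.Icc 1 b, s ≤ s₀ → c * Y 1 * (s ^ (-(κ / 2)) * Real.exp s) ≤ Y s := by
    intro s hs hss
    have h1 : s ^ (-(κ / 2)) ≤ s₀ ^ (|κ| / 2) := by
      calc s ^ (-(κ / 2)) ≤ s ^ (|κ| / 2) :=
            Real.rpow_le_rpow_of_exponent_le hs.1 (by linarith [neg_abs_le κ])
        _ ≤ _ := Real.rpow_le_rpow (by linarith [hs.1]) hss (by positivity)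
    have h2 : s ^ (-(κ / 2)) * Real.exp s ≤ M := by
      apply mul_le_mul h1 (Real.exp_le_exp.2 hss) (Real.exp_pos _).le
      exact Real.rpow_nonneg hs₀p.le _
    calc c * Y 1 * (s ^ (-(κ / 2)) * Real.exp s) ≤ c * Y 1 * M := by gcongr
      _ = c * M * Y 1 := by ring
      _ ≤ 1 * Y 1 := by gcongr
      _ ≤ Y s := by linarith [hYge s hs]
  intro s hs
  rcases le_total s s₀ with hss | hss
  · exact small s hs hss
  have hb : s₀ ≤ b := hss.trans hs.2
  have hsub : Set.Icc s₀ b ⊆ Set.Icc 1 b := Set.Icc_subset_Icc_left hs₀1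
  have hβ : ∀ s, s₀ ≤ s → |κ / (4 * s)| ≤ 1 / 2 := by
    intro s hs
    have hsp : 0 < s := hs₀p.trans_le hs
    have : |κ| / 2 ≤ s := (le_max_right _ _).trans hs
    rw [abs_div, abs_of_pos (by positivity : 0 < 4 * s), div_le_iff₀ (by positivity)]
    linarith
  set P : ℝ → ℝ := fun s => (1 - κ / (4 * s)) * Z s + (1 + κ / (4 * s)) * Y s with hP
  have hcontβ : ContinuousOn (fun s : ℝ => κ / (4 * s)) (Set.Icc s₀ b) :=
    continuousOn_const.div (by fun_prop) fun x hx => by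
      have := hs₀p.trans_le hx.1; positivity
  have hPc : ContinuousOn P (Set.Icc s₀ b) :=
    ((continuousOn_const.sub hcontβ).mul (h.cont_deriv.mono hsub)).add
      ((continuousOn_const.add hcontβ).mul (h.cont.mono hsub))
  have hWc : ContinuousOn W (Set.Icc s₀ b) := fun x hx =>
    (hasDerivAt_growth_weight κ (|κ| / 2) (hs₀p.trans_le hx.1)).continuousAt.continuousWithinAt
  have hmono : MonotoneOn (fun s => P s * W s) (Set.Icc s₀ b) := by
    refine monotoneOn_of_hasDerivAt (hPc.mul hWc) (fun x hx => ?_) (fun x hx => ?_)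
      (f' := fun x => ((((κ / 4 + κ ^ 2 / 8) * Z x + (- κ / 4 + κ ^ 2 / 8) * Y x) / x ^ 2
        + (1 - κ / (4 * x)) * r x) + |κ| / 2 / x ^ 2 * P x) * W x)
    · have hx0 : 0 < x := hs₀p.trans hx.1
      have hx1 : x ∈ Set.Ioo 1 b := ⟨hs₀1.trans_lt hx.1, hx.2⟩
      have hd := hasDerivAt_growth_functional (κ := κ) (w := r x) hx0 (h.hasDerivAt x hx1)
        (by simpa using h.hasDerivAt_deriv x hx1) rfl rfl
      refine (hd.fun_mul (hasDerivAt_growth_weight κ (|κ| / 2) hx0)).congr_deriv ?_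
      simp only [hP, hW]
      field_simp
      ring
    · have hx0 : 0 < x := hs₀p.trans hx.1
      have hx1 : x ∈ Set.Ioo 1 b := ⟨hs₀1.trans_lt hx.1, hx.2⟩
      have hy := hY1.le.trans (hYge x (Set.Ioo_subset_Icc_self hx1))
      have hz := hZge x (Set.Ioo_subset_Icc_self hx1)
      have hβx := abs_le.1 (hβ x hx.1.le)
      refine mul_nonneg ?_ (hWpos x hx0).le
      have e1 : 0 ≤ (1 - κ / (4 * x)) * r x := mul_nonneg (by linarith [hβx.2]) (h.nonneg x hx1)
      have e2 : (Z x + Y x) / 2 ≤ P x := by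
        simp only [hP]
        nlinarith [mul_nonneg (by linarith [hβx.2] : 0 ≤ 1 / 2 - κ / (4 * x)) hz,
          mul_nonneg (by linarith [hβx.1] : 0 ≤ 1 / 2 + κ / (4 * x)) hy]
      have e3 : |κ| / 2 / x ^ 2 * ((Z x + Y x) / 2) ≤ |κ| / 2 / x ^ 2 * P x := by gcongr
      have e4 : 0 ≤ ((κ / 4 + κ ^ 2 / 8) * Z x + (- κ / 4 + κ ^ 2 / 8) * Y x) / x ^ 2
          + |κ| / 2 / x ^ 2 * ((Z x + Y x) / 2) := by
        have : ((κ / 4 + κ ^ 2 / 8) * Z x + (- κ / 4 + κ ^ 2 / 8) * Y x) / x ^ 2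
          + |κ| / 2 / x ^ 2 * ((Z x + Y x) / 2) =
          (((κ + |κ|) / 4 + κ ^ 2 / 8) * Z x + ((|κ| - κ) / 4 + κ ^ 2 / 8) * Y x) / x ^ 2 := by
          field_simp
          ring
        rw [this]
        have := neg_abs_le κ
        have := le_abs_self κ
        have a1 : 0 ≤ (κ + |κ|) / 4 + κ ^ 2 / 8 := by nlinarith [sq_nonneg κ]
        have a2 : 0 ≤ (|κ| - κ) / 4 + κ ^ 2 / 8 := by nlinarith [sq_nonneg κ]
        positivity
      linarith
  have hlow : ∀ x ∈ Set.Icc s₀ b,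
      W s₀ / 3 * Y 1 * (x ^ (-(κ / 2)) * Real.exp x) ≤ Z x + Y x := by
    intro x hx
    have hx0 : 0 < x := hs₀p.trans_le hx.1
    have hx1 := hsub hx
    have hy := hY1.le.trans (hYge x hx1)
    have hz := hZge x hx1
    have hβx := abs_le.1 (hβ x hx.1)
    have hβ0 := abs_le.1 (hβ s₀ le_rfl)
    have h0 := hmono (Set.left_mem_Icc.2 hb) hx hx.1
    simp only at h0
    have e0 : Y 1 / 2 ≤ P s₀ := by
      have hs1 : s₀ ∈ Set.Icc 1 b := ⟨hs₀1, hb⟩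
      simp only [hP]
      have a1 := mul_nonneg (by linarith [hβ0.2] : 0 ≤ 1 - κ / (4 * s₀)) (hZge s₀ hs1)
      have a2 := hYge s₀ hs1
      nlinarith [mul_nonneg (by linarith [hβ0.1] : 0 ≤ 1 / 2 + κ / (4 * s₀)) (hY1.le.trans a2)]
    have e1 : P x ≤ 3 / 2 * (Z x + Y x) := by
      simp only [hP]
      nlinarith [mul_nonneg (by linarith [hβx.1] : 0 ≤ 1 / 2 + κ / (4 * x)) hz,
          mul_nonneg (by linarith [hβx.2] : 0 ≤ 1 / 2 - κ / (4 * x)) hy]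
    have e2 : W x * (x ^ (-(κ / 2)) * Real.exp x) ≤ 1 := by
      have : W x * (x ^ (-(κ / 2)) * Real.exp x) = Real.exp (-(|κ| / 2) / x) := by
        simp only [hW]
        rw [Real.rpow_neg hx0.le, Real.exp_neg]
        have := (Real.rpow_pos_of_pos hx0 (κ / 2)).ne'
        field_simp
      rw [this]
      apply Real.exp_le_one_iff.2
      have : 0 ≤ |κ| / 2 / x := by positivity
      rw [neg_div]; linarith
    have hwpos : 0 < x ^ (-(κ / 2)) * Real.exp x := by
      have := Real.rpow_pos_of_pos hx0 (-(κ / 2)); positivity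
    have hPx : 0 ≤ P x := by
      have := mul_nonneg (by linarith [hβx.2] : 0 ≤ 1 - κ / (4 * x)) hz
      have := mul_nonneg (by linarith [hβx.1] : 0 ≤ 1 + κ / (4 * x)) hy
      simp only [hP]; linarith
    have e3 : Y 1 / 2 * W s₀ ≤ P x * W x :=
      (mul_le_mul_of_nonneg_right e0 (hWpos s₀ hs₀p).le).trans h0
    have e4 : Y 1 / 2 * W s₀ * (x ^ (-(κ / 2)) * Real.exp x) ≤ P x := by
      calc _ ≤ P x * W x * (x ^ (-(κ / 2)) * Real.exp x) := by gcongr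
        _ = P x * (W x * (x ^ (-(κ / 2)) * Real.exp x)) := by ring
        _ ≤ P x * 1 := by gcongr
        _ = P x := mul_one _
    linarith
  have hwd : ∀ x, 0 < x → HasDerivAt (fun x => x ^ (-(κ / 2)) * Real.exp x)
      ((1 - κ / 2 / x) * (x ^ (-(κ / 2)) * Real.exp x)) x := by
    intro x hx
    refine ((Real.hasDerivAt_rpow_const (p := -(κ / 2)) (Or.inl hx.ne')).fun_mul
      (Real.hasDerivAt_exp x)).congr_deriv ?_
    rw [Real.rpow_sub_one hx.ne']
    field_simp
    ring
  -- The bound so far is for `Y' + Y = e^(-x) (e^x Y)'`. Multiplying by `e^x` and integrating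
  -- transfers it to `Y`; the comparison function then has rate `2 - κ/(2x) ≤ 2 + |κ|/2`.
  have hmono2 : MonotoneOn
      (fun x => Real.exp x * (Y x - c * Y 1 * (x ^ (-(κ / 2)) * Real.exp x))) (Set.Icc s₀ b) := by
    refine monotoneOn_of_hasDerivAt ?_ (fun x hx => ?_) (fun x hx => ?_)
      (f' := fun x => Real.exp x * (Z x + Y x
        - c * Y 1 * ((2 - κ / 2 / x) * (x ^ (-(κ / 2)) * Real.exp x))))
    · refine Real.continuous_exp.continuousOn.mul ((h.cont.mono hsub).sub
        (continuousOn_const.mul fun x hx => ?_))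
      exact (hwd x (hs₀p.trans_le hx.1)).continuousAt.continuousWithinAt
    · have hx0 : 0 < x := hs₀p.trans hx.1
      have hx1 : x ∈ Set.Ioo 1 b := ⟨hs₀1.trans_lt hx.1, hx.2⟩
      refine ((Real.hasDerivAt_exp x).fun_mul ((h.hasDerivAt x hx1).fun_sub
        ((hwd x hx0).const_mul (c * Y 1)))).congr_deriv ?_
      ring
    · have hx0 : 0 < x := hs₀p.trans hx.1
      have hx1 : 1 ≤ x := hs₀1.trans hx.1.le
      have hwpos : 0 < x ^ (-(κ / 2)) * Real.exp x := by
        have := Real.rpow_pos_of_pos hx0 (-(κ / 2)); positivity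
      refine mul_nonneg (Real.exp_pos _).le (sub_nonneg.2 ?_)
      refine le_trans ?_ (hlow x (Set.Ioo_subset_Icc_self hx))
      have a1 : 2 - κ / 2 / x ≤ 2 + |κ| / 2 := by
        have : -(κ / 2 / x) ≤ |κ| / 2 := by
          rw [← neg_div, div_le_iff₀ hx0]
          nlinarith [neg_abs_le κ, abs_nonneg κ]
        linarith
      calc c * Y 1 * ((2 - κ / 2 / x) * (x ^ (-(κ / 2)) * Real.exp x))
          ≤ c * Y 1 * ((2 + |κ| / 2) * (x ^ (-(κ / 2)) * Real.exp x)) := by gcongr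
        _ = c * (3 * (2 + |κ| / 2)) / 3 * Y 1 * (x ^ (-(κ / 2)) * Real.exp x) := by ring
        _ ≤ _ := by gcongr
  have h0 := hmono2 (Set.left_mem_Icc.2 hb) ⟨hss, hs.2⟩ hss
  simp only at h0
  have h1 := small s₀ ⟨hs₀1, hb⟩ le_rfl
  have h2 : 0 ≤ Real.exp s * (Y s - c * Y 1 * (s ^ (-(κ / 2)) * Real.exp s)) :=
    le_trans (mul_nonneg (Real.exp_pos _).le (sub_nonneg.2 h1)) h0
  exact sub_nonneg.1 (nonneg_of_mul_nonneg_right h2 (Real.exp_pos _))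

/-- Nonnegative increasing solutions of `Y'' + (κ / s) Y' = Y` grow at most like
`s ^ (-κ / 2) e ^ s`. -/
theorem exists_growth_upper {κ : ℝ} (hκ : 0 ≤ κ) {Y Z : ℝ → ℝ} (hYc : Continuous Y)
    (hY : ∀ s, 0 < s → HasDerivAt Y (Z s) s)
    (hZ : ∀ s, 0 < s → HasDerivAt Z (Y s - κ / s * Z s) s)
    (hY0 : ∀ s, 0 < s → 0 ≤ Y s) (hZ0 : ∀ s, 0 < s → 0 ≤ Z s) :
    ∃ C : ℝ, 0 < C ∧ ∀ s, 0 ≤ s → Y s ≤ C * ((1 + s) ^ (-(κ / 2)) * Real.exp s) := by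
  set s₀ : ℝ := max 1 (κ / 2) with hs₀
  have hs₀1 : 1 ≤ s₀ := le_max_left _ _
  have hs₀p : 0 < s₀ := one_pos.trans_le hs₀1
  -- `C/2` is the larger of the two error coefficients `±κ/4 + κ²/8`, so the weight with parameter
  -- `-C` makes `P * W` nonincreasing.
  set C : ℝ := κ / 2 + κ ^ 2 / 4 with hC
  set W : ℝ → ℝ := fun s => s ^ (κ / 2) * (Real.exp (-s) * Real.exp (-(-C) / s)) with hW
  have hWpos : ∀ s, 0 < s → 0 < W s := fun s hs => by
    simp only [hW]; have := Real.rpow_pos_of_pos hs (κ / 2); positivity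
  have hβ : ∀ s, s₀ ≤ s → 0 ≤ κ / (4 * s) ∧ κ / (4 * s) ≤ 1 / 2 := by
    intro s hs
    have hsp : 0 < s := hs₀p.trans_le hs
    have : κ / 2 ≤ s := (le_max_right _ _).trans hs
    refine ⟨by positivity, ?_⟩
    rw [div_le_iff₀ (by positivity)]
    linarith
  set P : ℝ → ℝ := fun s => (1 - κ / (4 * s)) * Z s + (1 + κ / (4 * s)) * Y s with hP
  have hPW : ∀ x, s₀ ≤ x → HasDerivAt (fun s => -(P s * W s))
      ((C / x ^ 2 * P x
        - ((κ / 4 + κ ^ 2 / 8) * Z x + (- κ / 4 + κ ^ 2 / 8) * Y x) / x ^ 2) * W x) x := by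
    intro x hx
    have hx0 : 0 < x := hs₀p.trans_le hx
    have hd := hasDerivAt_growth_functional (κ := κ) (w := 0) hx0 (hY x hx0)
      (by simpa using hZ x hx0) rfl rfl
    refine (hd.fun_mul (hasDerivAt_growth_weight κ (-C) hx0)).fun_neg.congr_deriv ?_
    simp only [hP, hW]
    field_simp
    ring
  have hP2 : ∀ x, s₀ ≤ x → (Z x + Y x) / 2 ≤ P x := by
    intro x hx
    have hx0 : 0 < x := hs₀p.trans_le hx
    have := hβ x hx
    simp only [hP]
    nlinarith [mul_nonneg (by linarith : 0 ≤ 1 / 2 - κ / (4 * x)) (hZ0 x hx0),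
      mul_nonneg (by linarith : 0 ≤ 1 / 2 + κ / (4 * x)) (hY0 x hx0)]
  have hanti : ∀ x, s₀ ≤ x → P x * W x ≤ P s₀ * W s₀ := by
    intro b hb
    have hmono : MonotoneOn (fun s => -(P s * W s)) (Set.Icc s₀ b) := by
      refine monotoneOn_of_hasDerivAt
        (fun x hx => (hPW x hx.1).continuousAt.continuousWithinAt) (fun x hx => hPW x hx.1.le)
        fun x hx => ?_
      have hx0 : 0 < x := hs₀p.trans hx.1
      refine mul_nonneg ?_ (hWpos x hx0).le
      have e2 := hP2 x hx.1.le
      have hCn : 0 ≤ C := by positivity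
      have e3 : C / x ^ 2 * ((Z x + Y x) / 2) ≤ C / x ^ 2 * P x := by gcongr
      have e4 : C / x ^ 2 * ((Z x + Y x) / 2)
          - ((κ / 4 + κ ^ 2 / 8) * Z x + (- κ / 4 + κ ^ 2 / 8) * Y x) / x ^ 2
          = κ / 2 * Y x / x ^ 2 := by
        rw [hC]
        field_simp
        ring
      have e5 : 0 ≤ κ / 2 * Y x / x ^ 2 := by
        have := hY0 x hx0
        positivity
      linarith
    have := hmono (Set.left_mem_Icc.2 hb) (Set.right_mem_Icc.2 hb) hb
    simp only at this
    linarith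
  obtain ⟨D, hD⟩ := (isCompact_Icc (a := (0 : ℝ)) (b := s₀)).bddAbove_image
    (f := fun s => Y s * ((1 + s) ^ (κ / 2) * Real.exp (-s)))
    (hYc.continuousOn.mul (((continuousOn_const.add continuousOn_id).rpow_const
      fun x hx => Or.inl (by linarith [hx.1] : (0 : ℝ) < 1 + x).ne').mul (by fun_prop)))
  refine ⟨max 1 (max D (2 * (P s₀ * W s₀) * 2 ^ (κ / 2))), by positivity, fun s hs => ?_⟩
  have h1s : 0 < 1 + s := by linarith
  have hpos1 := Real.rpow_pos_of_pos h1s (κ / 2)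
  have hpos := Real.rpow_pos_of_pos h1s (-(κ / 2))
  rcases le_total s s₀ with hss | hss
  · have h1 : Y s * ((1 + s) ^ (κ / 2) * Real.exp (-s)) ≤ D := hD ⟨s, ⟨hs, hss⟩, rfl⟩
    have h2 : D ≤ max 1 (max D (2 * (P s₀ * W s₀) * 2 ^ (κ / 2))) :=
      (le_max_left _ _).trans (le_max_right _ _)
    calc Y s = Y s * ((1 + s) ^ (κ / 2) * Real.exp (-s)) *
          ((1 + s) ^ (-(κ / 2)) * Real.exp s) := by
          rw [Real.rpow_neg h1s.le, Real.exp_neg]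
          field_simp
      _ ≤ _ := by gcongr; exact h1.trans h2
  · have hsp : 0 < s := hs₀p.trans_le hss
    have hpos2 := Real.rpow_pos_of_pos hsp (κ / 2)
    have h1 := hanti s hss
    have h2 := hP2 s hss
    have hP0 : 0 ≤ P s := by linarith [hZ0 s hsp, hY0 s hsp]
    have h3 : P s * (s ^ (κ / 2) * Real.exp (-s)) ≤ P s₀ * W s₀ := by
      refine le_trans ?_ h1
      simp only [hW]
      gcongr
      have : 1 ≤ Real.exp (-(-C) / s) := by
        apply Real.one_le_exp
        rw [neg_neg]; positivity
      exact le_mul_of_one_le_right (Real.exp_pos _).le this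
    have h4 : (1 + s) ^ (κ / 2) ≤ 2 ^ (κ / 2) * s ^ (κ / 2) := by
      rw [← Real.mul_rpow (by norm_num) hsp.le]
      exact Real.rpow_le_rpow h1s.le (by linarith) (by positivity)
    have h5 : Y s ≤ 2 * P s := by linarith [hZ0 s hsp]
    have hD2 : 2 * (P s₀ * W s₀) * 2 ^ (κ / 2) ≤ max 1 (max D (2 * (P s₀ * W s₀) * 2 ^ (κ / 2))) :=
      (le_max_right _ _).trans (le_max_right _ _)
    calc Y s ≤ 2 * P s := h5
      _ = 2 * P s * ((1 + s) ^ (κ / 2) * Real.exp (-s)) *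
          ((1 + s) ^ (-(κ / 2)) * Real.exp s) := by
          rw [Real.rpow_neg h1s.le, Real.exp_neg]
          field_simp
      _ ≤ 2 * P s * (2 ^ (κ / 2) * s ^ (κ / 2) * Real.exp (-s)) *
          ((1 + s) ^ (-(κ / 2)) * Real.exp s) := by gcongr
      _ = 2 * (P s * (s ^ (κ / 2) * Real.exp (-s))) * 2 ^ (κ / 2) *
          ((1 + s) ^ (-(κ / 2)) * Real.exp s) := by ring
      _ ≤ 2 * (P s₀ * W s₀) * 2 ^ (κ / 2) * ((1 + s) ^ (-(κ / 2)) * Real.exp s) := by gcongr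
      _ ≤ _ := by gcongr

/-! ### Power weights, linear comparison and blow-up on a window -/

lemma hasDerivAt_rpow_mul (c : ℝ) {Y : ℝ → ℝ} {z s : ℝ} (hs : 0 < s) (hY : HasDerivAt Y z s) :
    HasDerivAt (fun s => s ^ c * Y s) (s ^ c * (z + c / s * Y s)) s := by
  refine ((Real.hasDerivAt_rpow_const (p := c) (Or.inl hs.ne')).fun_mul hY).congr_deriv ?_
  rw [Real.rpow_sub_one hs.ne']
  field_simp
  ring

/-- Removing the factor `s ^ (-m)`, where `m (m + 1 - μ) = 0`. -/
lemma DampedODE.rpow_mul {μ m b : ℝ} (hm : m * (m + 1 - μ) = 0) {Y Z r : ℝ → ℝ}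
    (h : DampedODE μ 1 b Y Z r) : DampedODE (μ - 2 * m) 1 b (fun s => s ^ m * Y s)
      (fun s => s ^ m * (Z s + m / s * Y s)) (fun s => s ^ m * r s) where
  cont := continuousOn_rpow_mul m one_pos h.cont
  cont_deriv := continuousOn_rpow_mul m one_pos (h.cont_deriv.add
    ((continuousOn_const.div continuousOn_id fun _ hx => (one_pos.trans_le hx.1).ne').mul h.cont))
  hasDerivAt s hs := hasDerivAt_rpow_mul m (one_pos.trans hs.1) (h.hasDerivAt s hs)
  hasDerivAt_deriv s hs := by
    have hs0 : 0 < s := one_pos.trans hs.1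
    have h4 : HasDerivAt (fun s : ℝ => m / s) (- m / s ^ 2) s := by
      refine ((hasDerivAt_inv hs0.ne').const_mul m).congr_deriv ?_
      field_simp
    refine (hasDerivAt_rpow_mul m hs0 ((h.hasDerivAt_deriv s hs).fun_add
      (h4.fun_mul (h.hasDerivAt s hs)))).congr_deriv ?_
    have : m * m = m * (μ - 1) := by linarith
    field_simp
    linear_combination (-Y s) * this
  nonneg s hs := mul_nonneg (Real.rpow_nonneg (one_pos.trans hs.1).le _) (h.nonneg s hs)

/-- Lower bound for the weighted average of a solution. -/
theorem exists_weighted_lower {μ m : ℝ} (hm : m * (m + 1 - μ) = 0) : ∃ c : ℝ, 0 < c ∧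
    ∀ (b : ℝ) (Y Z r : ℝ → ℝ), DampedODE μ 1 b Y Z r → 0 < Y 1 → Z 1 = -(m * Y 1) →
      ∀ s ∈ Set.Icc 1 b, c * Y 1 * (s ^ (-(μ / 2)) * Real.exp s) ≤ Y s := by
  obtain ⟨c, hc, H⟩ := exists_growth_lower (μ - 2 * m)
  refine ⟨c, hc, fun b Y Z r h hY hZ s hs => ?_⟩
  -- Multiplication by `s^m` makes the initial derivative vanish and changes the damping to `μ -
  -- 2m`, possibly negative. The resulting rate `s^(m-μ/2) e^s` gives back `s^(-μ/2) e^s` after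
  -- division by `s^m`.
  have := H b _ _ _ (h.rpow_mul hm) (by simpa using hY) (by simp [hZ]) s hs
  have hs0 : 0 < s := one_pos.trans_le hs.1
  simp only [Real.one_rpow, one_mul] at this
  rw [show -((μ - 2 * m) / 2) = m + -(μ / 2) by ring, Real.rpow_add hs0] at this
  have hp := Real.rpow_pos_of_pos hs0 m
  refine le_of_mul_le_mul_left ?_ hp
  linarith

/-- Subtracting the solution `I s ^ (-m)` of the homogeneous equation. -/
lemma DampedODE.sub_linear {μ m b : ℝ} (hm : m * (m + 1 - μ) = 0) {Y Z r : ℝ → ℝ}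
    (h : DampedODE μ 0 b Y Z r) (I : ℝ) : DampedODE μ 0 b (fun s => Y s - I * s ^ (-m))
      (fun s => Z s + m * I * s ^ (-m - 1)) r where
  cont := h.cont.sub (continuousOn_const.mul (continuousOn_id.rpow_const
    fun _ hx => Or.inl (one_pos.trans_le hx.1).ne'))
  cont_deriv := h.cont_deriv.add (continuousOn_const.mul (continuousOn_id.rpow_const
    fun _ hx => Or.inl (one_pos.trans_le hx.1).ne'))
  hasDerivAt s hs := by
    refine ((h.hasDerivAt s hs).fun_sub ((Real.hasDerivAt_rpow_const (p := -m)
      (Or.inl (one_pos.trans hs.1).ne')).const_mul I)).congr_deriv ?_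
    ring
  hasDerivAt_deriv s hs := by
    have hs0 : 0 < s := one_pos.trans hs.1
    refine ((h.hasDerivAt_deriv s hs).fun_add ((Real.hasDerivAt_rpow_const (p := -m - 1)
      (Or.inl (one_pos.trans hs.1).ne')).const_mul (m * I))).congr_deriv ?_
    rw [Real.rpow_sub_one hs0.ne' (-m - 1)]
    field_simp
    linear_combination (- I * s ^ (-m - 1)) * hm
  nonneg := h.nonneg

/-- The linear lower bound and the gain from the nonlinear term. -/
lemma DampedODE.step {μ m b I : ℝ} (hμ : 0 ≤ μ) (hm : m * (m + 1 - μ) = 0) {Y Z r : ℝ → ℝ}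
    (h : DampedODE μ 0 b Y Z r) (hY : Y 1 = I) (hZ : Z 1 = -(m * I)) :
    (∀ s ∈ Set.Icc 1 b, I * s ^ (-m) ≤ Y s) ∧
    ∀ M s₁ s₂ : ℝ, 0 ≤ M → 1 ≤ s₁ → s₁ ≤ s₂ → s₂ ≤ b → (∀ s ∈ Set.Ioo s₁ s₂, M ≤ r s) →
      ∀ s ∈ Set.Icc s₁ s₂, I * s ^ (-m) + (s₁ / s₂) ^ μ * M * (s - s₁) ^ 2 / 2 ≤ Y s := by
  have hE := h.sub_linear hm I
  have hE0 : Z 1 + m * I * (1 : ℝ) ^ (-m - 1) = 0 := by simp [hZ]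
  have hmono := hE.monotoneOn hE0.ge (by simp)
  have hEpos : ∀ s ∈ Set.Icc 1 b, 0 ≤ Y s - I * s ^ (-m) := by
    intro s hs
    have := hmono (Set.left_mem_Icc.2 (hs.1.trans hs.2)) hs hs.1
    simpa [hY] using this
  refine ⟨fun s hs => sub_nonneg.1 (hEpos s hs), ?_⟩
  intro M s₁ s₂ hM h1 h12 h2 hr
  have hsub : Set.Icc s₁ s₂ ⊆ Set.Icc 1 b := Set.Icc_subset_Icc h1 h2
  have hs₁ : 0 < s₁ := one_pos.trans_le h1
  -- First integration, for `E = Y - I s^(-m)`: `(s^μ E')' = s^μ r ≥ s₁^μ M`. Dividing by `s^μ ≤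
  -- s₂^μ` costs the factor `(s₁/s₂)^μ`.
  have hE' : ∀ s ∈ Set.Icc s₁ s₂,
      (s₁ / s₂) ^ μ * M * (s - s₁) ≤ Z s + m * I * s ^ (-m - 1) := by
    have hmm : MonotoneOn (fun s => s ^ μ * (Z s + m * I * s ^ (-m - 1)) - s₁ ^ μ * M * (s - s₁))
        (Set.Icc s₁ s₂) := by
      refine monotoneOn_of_hasDerivAt (((DampedODE.continuousOn_rpow_mul μ one_pos hE.cont_deriv).mono
        hsub).sub (by fun_prop)) (fun x hx => ?_) (fun x hx => ?_)
        (f' := fun x => x ^ μ * r x - s₁ ^ μ * M)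
      · refine ((hE.hasDerivAt_weight (s := x) ⟨h1.trans_lt hx.1, hx.2.trans_le h2⟩).fun_sub
          (((hasDerivAt_id x).sub_const s₁).const_mul (s₁ ^ μ * M))).congr_deriv ?_
        simp
      · have a := Real.rpow_le_rpow hs₁.le hx.1.le hμ
        have := hr x hx
        exact sub_nonneg.2 (mul_le_mul a this hM (Real.rpow_nonneg (hs₁.trans hx.1).le _))
    intro s hs
    have hs0 : 0 < s := hs₁.trans_le hs.1
    have hs₂ : 0 < s₂ := hs₁.trans_le h12
    have h0 := hmm (Set.left_mem_Icc.2 h12) hs hs.1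
    simp only [sub_self, mul_zero, sub_zero] at h0
    have h3 := hE.deriv_nonneg hE0.ge (by simp) s₁ (hsub (Set.left_mem_Icc.2 h12))
    have h4 : 0 ≤ s₁ ^ μ * (Z s₁ + m * I * s₁ ^ (-m - 1)) :=
      mul_nonneg (Real.rpow_nonneg hs₁.le _) h3
    have h5 := hE.deriv_nonneg hE0.ge (by simp) s (hsub hs)
    have h6 : s ^ μ ≤ s₂ ^ μ := Real.rpow_le_rpow hs0.le hs.2 hμ
    rw [Real.div_rpow hs₁.le hs₂.le]
    have hp := Real.rpow_pos_of_pos hs₂ μ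
    rw [div_mul_eq_mul_div, div_mul_eq_mul_div, div_le_iff₀ hp]
    have := mul_le_mul_of_nonneg_right h6 h5
    linarith
  have hmm : MonotoneOn (fun s => (Y s - I * s ^ (-m)) - (s₁ / s₂) ^ μ * M * (s - s₁) ^ 2 / 2)
      (Set.Icc s₁ s₂) := by
    refine monotoneOn_of_hasDerivAt ((hE.cont.mono hsub).sub (by fun_prop)) (fun x hx => ?_)
      (fun x hx => ?_)
      (f' := fun x => Z x + m * I * x ^ (-m - 1) - (s₁ / s₂) ^ μ * M * (x - s₁))
    · refine ((hE.hasDerivAt x ⟨h1.trans_lt hx.1, hx.2.trans_le h2⟩).fun_sub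
          (((((hasDerivAt_id x).sub_const s₁).fun_pow 2).const_mul
            ((s₁ / s₂) ^ μ * M)).div_const 2)).congr_deriv ?_
      simp
      ring
    · exact sub_nonneg.2 (hE' x (Set.Ioo_subset_Icc_self hx))
  intro s hs
  have h0 := hmm (Set.left_mem_Icc.2 h12) hs hs.1
  have h3 := hEpos s₁ (hsub (Set.left_mem_Icc.2 h12))
  simp only [sub_self, ne_eq, OfNat.ofNat_ne_zero, not_false_eq_true, zero_pow, mul_zero, zero_div,
    sub_zero] at h0
  linarith

/-- Blow-up on the scale `[S, 2 S]`. -/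
theorem exists_blowup_bound {μ p : ℝ} (hμ : 0 ≤ μ) (hp : 1 < p) : ∃ K : ℝ, 0 < K ∧
    ∀ (m I S β A : ℝ) (Y Z r : ℝ → ℝ), m * (m + 1 - μ) = 0 → DampedODE μ 0 (2 * S) Y Z r →
      Y 1 = I → 0 ≤ I → Z 1 = -(m * I) → 1 ≤ S → 0 < A → 0 < β →
      (∀ s ∈ Set.Icc S (2 * S), A ≤ Y s) →
      (∀ s ∈ Set.Ioo S (2 * S), β * Y s ^ p ≤ r s) →
      β * A ^ (p - 1) * S ^ 2 ≤ K := by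
  -- Each doubling of `Y` needs `θ` times the time of the previous one, since the time scale at
  -- height `A` is `(β A^(p-1))^(-1/2)`.
  set θ : ℝ := (2 : ℝ) ^ (-((p - 1) / 2)) with hθ
  have hθ0 : 0 < θ := Real.rpow_pos_of_pos two_pos _
  have hθ1 : θ < 1 := Real.rpow_lt_one_of_one_lt_of_neg one_lt_two (by linarith)
  have h2μ : 0 < (2 : ℝ) ^ μ := Real.rpow_pos_of_pos two_pos _
  refine ⟨4 * 2 ^ μ * (1 - θ)⁻¹ ^ 2, by have := sub_pos.2 hθ1; positivity, ?_⟩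
  intro m I S β A Y Z r hm h hY hI hZ hS hA hβ hAY hr
  by_contra! hcon
  have hS0 : 0 < S := one_pos.trans_le hS
  obtain ⟨-, hstep⟩ := h.step hμ hm hY hZ
  have hAp : 0 < A ^ (p - 1) := Real.rpow_pos_of_pos hA _
  -- `δ` is the time for the first doubling; the factor `2^μ` pays for the damping across `[S, 2S]`.
  -- All doublings together take at most `δ/(1-θ) < S`, so they would all fit before `2S`.
  set δ : ℝ := Real.sqrt (4 * 2 ^ μ / (β * A ^ (p - 1))) with hδ
  have hδ2 : δ ^ 2 = 4 * 2 ^ μ / (β * A ^ (p - 1)) := Real.sq_sqrt (by positivity)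
  have hδ0 : 0 < δ := Real.sqrt_pos.2 (by positivity)
  have hδS : δ * (1 - θ)⁻¹ < S := by
    have h1θ : 0 < 1 - θ := sub_pos.2 hθ1
    refine lt_of_pow_lt_pow_left₀ 2 hS0.le ?_
    rw [mul_pow, hδ2, div_mul_eq_mul_div, div_lt_iff₀ (by positivity)]
    linarith
  set σ : ℕ → ℝ := fun j => S + δ * ∑ i ∈ Finset.range j, θ ^ i with hσ
  have hσ_lt : ∀ j, σ j < 2 * S := by
    intro j
    have h1 : ∑ i ∈ Finset.range j, θ ^ i ≤ (1 - θ)⁻¹ := by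
      rw [← tsum_geometric_of_lt_one hθ0.le hθ1]
      exact (summable_geometric_of_lt_one hθ0.le hθ1).sum_le_tsum _ fun i _ => by positivity
    have := mul_le_mul_of_nonneg_left h1 hδ0.le
    simp only [hσ]
    linarith
  have hσ_succ : ∀ j, σ (j + 1) = σ j + δ * θ ^ j := by
    intro j; simp only [hσ, Finset.sum_range_succ]; ring
  have hσ_ge : ∀ j, S ≤ σ j := by
    intro j
    have : 0 ≤ ∑ i ∈ Finset.range j, θ ^ i := Finset.sum_nonneg fun i _ => by positivity
    simp only [hσ]; nlinarith
  have key : ∀ j, ∀ s ∈ Set.Icc (σ j) (2 * S), A * 2 ^ j ≤ Y s := by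
    intro j
    induction j with
    | zero => intro s hs; simpa using hAY s ⟨(hσ_ge 0).trans hs.1, hs.2⟩
    | succ j ih =>
      intro s hs
      have hsj : σ j ≤ σ (j + 1) := by rw [hσ_succ]; have : 0 ≤ δ * θ ^ j := by positivity
                                       linarith
      have hσj : 0 < σ j := hS0.trans_le (hσ_ge j)
      have := hstep (β * (A * 2 ^ j) ^ p) (σ j) (2 * S) (by positivity) (hS.trans (hσ_ge j))
        (hσ_lt j).le le_rfl (fun x hx => by
          refine le_trans ?_ (hr x ⟨(hσ_ge j).trans_lt hx.1, hx.2⟩)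
          gcongr
          exact ih x (Set.Ioo_subset_Icc_self hx)) s ⟨hsj.trans hs.1, hs.2⟩
      refine le_trans ?_ this
      have e1 : (2 : ℝ) ^ (-μ) ≤ (σ j / (2 * S)) ^ μ := by
        rw [Real.rpow_neg two_pos.le, ← Real.inv_rpow two_pos.le]
        refine Real.rpow_le_rpow (by norm_num) ?_ hμ
        rw [le_div_iff₀ (by positivity)]
        have := hσ_ge j
        linarith
      have e2 : δ * θ ^ j ≤ s - σ j := by have := hs.1; rw [hσ_succ] at this; linarith
      have e3 : (A * 2 ^ j) ^ p = A * A ^ (p - 1) * (2 ^ j * ((2 : ℝ) ^ j) ^ (p - 1)) := by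
        have a1 : ∀ x : ℝ, 0 < x → x ^ p = x * x ^ (p - 1) := fun x hx => by
          rw [Real.rpow_sub_one hx.ne']; field_simp
        rw [Real.mul_rpow hA.le (by positivity), a1 A hA, a1 (2 ^ j) (by positivity)]
      have e4 : ((2 : ℝ) ^ j) ^ (p - 1) * (θ ^ j) ^ 2 = 1 := by
        rw [hθ, ← Real.rpow_natCast, ← Real.rpow_natCast, ← Real.rpow_natCast, ← Real.rpow_mul two_pos.le,
          ← Real.rpow_mul two_pos.le, ← Real.rpow_mul two_pos.le, ← Real.rpow_add two_pos]
        rw [show (j : ℝ) * (p - 1) + -((p - 1) / 2) * j * (2 : ℕ) = 0 by push_cast; ring,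
          Real.rpow_zero]
      have e5 : A * 2 ^ (j + 1) = 2 ^ (-μ) * (β * (A * 2 ^ j) ^ p) * (δ * θ ^ j) ^ 2 / 2 := by
        rw [e3, mul_pow, hδ2, Real.rpow_neg two_pos.le]
        field_simp
        linear_combination (-4 * 2 ^ j : ℝ) * e4
      have hs0 : 0 < s := hσj.trans_le (hsj.trans hs.1)
      have e6 : 0 ≤ I * s ^ (-m) := mul_nonneg hI (Real.rpow_nonneg hs0.le _)
      have e7 : 2 ^ (-μ) * (β * (A * 2 ^ j) ^ p) * (δ * θ ^ j) ^ 2 / 2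
          ≤ (σ j / (2 * S)) ^ μ * (β * (A * 2 ^ j) ^ p) * (s - σ j) ^ 2 / 2 := by
        gcongr
      linarith
  obtain ⟨j, hj⟩ := pow_unbounded_of_one_lt (Y (2 * S) / A) one_lt_two
  have := key j (2 * S) ⟨(hσ_lt j).le, le_rfl⟩
  rw [div_lt_iff₀ hA] at hj
  linarith

/-! ### A positive radial solution of `Δ φ = φ` -/

/-- The coefficients `1 / (4 ^ k k! (ν)_k)`. -/
noncomputable def besselCoeff (ν : ℝ) (k : ℕ) : ℝ :=
  (4 ^ k * (k.factorial : ℝ) * (ascPochhammer ℝ k).eval ν)⁻¹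

/-- The entire function `∑ q ^ k / (4 ^ k k! (ν)_k)`, a normalized modified Bessel function. -/
noncomputable def besselSeries (ν q : ℝ) : ℝ := ∑' k : ℕ, q ^ k * besselCoeff ν k

lemma ascPochhammer_eval_succ_left (ν : ℝ) (k : ℕ) :
    (ascPochhammer ℝ (k + 1)).eval ν = ν * (ascPochhammer ℝ k).eval (ν + 1) := by
  simp [ascPochhammer_succ_left]

lemma pow_le_ascPochhammer_eval {ν : ℝ} (hν : 0 < ν) (k : ℕ) :
    ν ^ k ≤ (ascPochhammer ℝ k).eval ν := by
  induction k with
  | zero => simp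
  | succ k ih =>
    rw [ascPochhammer_succ_eval, pow_succ]
    gcongr
    · exact (ascPochhammer_pos k ν hν).le
    · have : (0 : ℝ) ≤ k := by positivity
      linarith

lemma besselCoeff_pos {ν : ℝ} (hν : 0 < ν) (k : ℕ) : 0 < besselCoeff ν k := by
  have := ascPochhammer_pos k ν hν
  have := Nat.factorial_pos k
  unfold besselCoeff
  positivity

@[simp] lemma besselCoeff_zero (ν : ℝ) : besselCoeff ν 0 = 1 := by simp [besselCoeff]

lemma succ_mul_besselCoeff_succ (ν : ℝ) (k : ℕ) :
    (k + 1) * besselCoeff ν (k + 1) = besselCoeff (ν + 1) k / (4 * ν) := by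
  have : (k : ℝ) + 1 ≠ 0 := by positivity
  simp only [besselCoeff, ascPochhammer_eval_succ_left, Nat.factorial_succ, pow_succ, mul_inv,
    div_eq_mul_inv]
  push_cast
  simp only [mul_inv]
  field_simp

/-- Coefficient form of the contiguous relation `besselSeries_eq`, which encodes the Bessel
equation. -/
lemma besselCoeff_succ_eq {ν : ℝ} (hν : 0 < ν) (k : ℕ) : besselCoeff ν (k + 1) =
    besselCoeff (ν + 1) (k + 1) + besselCoeff (ν + 2) k / (4 * ν * (ν + 1)) := by
  have hA := ascPochhammer_pos k (ν + 2) (by linarith)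
  have hB := ascPochhammer_pos k (ν + 1) (by linarith)
  have h1 := ascPochhammer_eval_succ_left (ν + 1) k
  have h2 := ascPochhammer_succ_eval k (ν + 1)
  rw [show ν + 1 + 1 = ν + 2 by ring] at h1
  have h3 : (ascPochhammer ℝ k).eval (ν + 2) =
      (ascPochhammer ℝ k).eval (ν + 1) * (ν + 1 + k) / (ν + 1) := by
    rw [← h2, h1]; field_simp
  simp only [besselCoeff, ascPochhammer_eval_succ_left, Nat.factorial_succ, pow_succ]
  rw [show ν + 1 + 1 = ν + 2 by ring, h3]
  have : (k.factorial : ℝ) ≠ 0 := by positivity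
  have : (ν + 1 + k) ≠ 0 := by positivity
  push_cast
  field_simp
  ring

lemma summable_besselSeries {ν : ℝ} (hν : 0 < ν) (q : ℝ) :
    Summable fun k : ℕ => q ^ k * besselCoeff ν k := by
  refine Summable.of_norm_bounded (Real.summable_pow_div_factorial (|q| / (4 * ν))) fun k => ?_
  rw [norm_mul, norm_pow, Real.norm_eq_abs, Real.norm_eq_abs, abs_of_pos (besselCoeff_pos hν k),
    div_pow, mul_pow, besselCoeff]
  have h := pow_le_ascPochhammer_eval hν k
  have hνk : 0 < ν ^ k := pow_pos hν k
  have hf : (0 : ℝ) < k.factorial := by positivity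
  calc |q| ^ k * (4 ^ k * (k.factorial : ℝ) * (ascPochhammer ℝ k).eval ν)⁻¹
      ≤ |q| ^ k * (4 ^ k * (k.factorial : ℝ) * ν ^ k)⁻¹ := by gcongr
    _ = _ := by field_simp

/-- Termwise differentiation shifts the parameter by one. The terms on the ball of radius `|q| + 1`
are dominated by those of the shifted series at `|q| + 1`. -/
lemma hasDerivAt_besselSeries {ν : ℝ} (hν : 0 < ν) (q : ℝ) :
    HasDerivAt (besselSeries ν) (besselSeries (ν + 1) q / (4 * ν)) q := by
  have hν1 : 0 < ν + 1 := by linarith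
  have hfun : besselSeries ν = fun q => 1 + ∑' k : ℕ, q ^ (k + 1) * besselCoeff ν (k + 1) := by
    funext q
    rw [besselSeries, (summable_besselSeries hν q).tsum_eq_zero_add]
    simp
  have hs : Summable fun k : ℕ => (|q| + 1) ^ k * besselCoeff (ν + 1) k / (4 * ν) :=
    (summable_besselSeries hν1 _).div_const _
  have hd := hasDerivAt_tsum_of_isPreconnected (t := Metric.ball (0 : ℝ) (|q| + 1)) (y₀ := 0)
    (y := q) (g := fun (k : ℕ) q => q ^ (k + 1) * besselCoeff ν (k + 1))
    (g' := fun (k : ℕ) q => q ^ k * besselCoeff (ν + 1) k / (4 * ν)) hs Metric.isOpen_ball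
    (convex_ball _ _).isPreconnected (fun k y _ => by
      refine ((hasDerivAt_pow (k + 1) y).mul_const _).congr_deriv ?_
      rw [mul_div_assoc, ← succ_mul_besselCoeff_succ]
      push_cast
      ring) (fun k y hy => by
      have hy' : |y| ≤ |q| + 1 := by simpa using (mem_ball_zero_iff.1 hy).le
      have := besselCoeff_pos hν1 k
      rw [norm_div, norm_mul, norm_pow, Real.norm_eq_abs, Real.norm_eq_abs, Real.norm_eq_abs,
        abs_of_pos this, abs_of_pos (by positivity : 0 < 4 * ν)]
      gcongr) (Metric.mem_ball_self (by positivity)) (by simp)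
      (by simp)
  rw [hfun]
  refine (hd.const_add 1).congr_deriv ?_
  rw [tsum_div_const, besselSeries]

lemma contDiff_besselSeries {ν : ℝ} (hν : 0 < ν) : ContDiff ℝ ∞ (besselSeries ν) := by
  rw [contDiff_infty]
  intro N
  induction N generalizing ν with
  | zero =>
    exact contDiff_zero.2 (continuous_iff_continuousAt.2 fun q =>
      (hasDerivAt_besselSeries hν q).continuousAt)
  | succ N ih =>
    push_cast
    rw [contDiff_succ_iff_deriv]
    refine ⟨fun q => (hasDerivAt_besselSeries hν q).differentiableAt, by simp, ?_⟩
    rw [funext fun q => (hasDerivAt_besselSeries hν q).deriv]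
    exact (ih (by linarith)).div_const _

/-- With the derivative formula applied twice, this is the equation `4q F'' + 4ν F' = F`. -/
lemma besselSeries_eq {ν : ℝ} (hν : 0 < ν) (q : ℝ) : besselSeries ν q =
    besselSeries (ν + 1) q + q * (besselSeries (ν + 2) q / (4 * ν * (ν + 1))) := by
  have h2 : 0 < ν + 2 := by linarith
  have h1 : 0 < ν + 1 := by linarith
  have hs1 := (summable_nat_add_iff 1).2 (summable_besselSeries h1 q)
  have hs2 := ((summable_besselSeries h2 q).div_const (4 * ν * (ν + 1))).mul_left q
  rw [besselSeries, (summable_besselSeries hν q).tsum_eq_zero_add, besselSeries,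
    (summable_besselSeries h1 q).tsum_eq_zero_add, besselSeries, ← tsum_div_const, ← tsum_mul_left,
    add_assoc, ← hs1.tsum_add hs2]
  simp only [pow_zero, besselCoeff_zero]
  congr 1
  refine tsum_congr fun k => ?_
  rw [besselCoeff_succ_eq hν]
  ring

lemma one_le_besselSeries {ν q : ℝ} (hν : 0 < ν) (hq : 0 ≤ q) : 1 ≤ besselSeries ν q := by
  have := (summable_besselSeries hν q).le_tsum 0 fun k _ =>
    mul_nonneg (pow_nonneg hq k) (besselCoeff_pos hν k).le
  simpa [besselSeries] using this

/-- A positive radial solution of `Δ φ = φ` on `ℝⁿ`. -/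
noncomputable def radialEigen {n : ℕ} (x : Space n) : ℝ := besselSeries (n / 2) (‖x‖ ^ 2)

lemma contDiff_radialEigen {n : ℕ} (hn : 1 ≤ n) : ContDiff ℝ ∞ (radialEigen (n := n)) := by
  have hn' : (0 : ℝ) < n / 2 := by positivity
  exact (contDiff_besselSeries hn').comp (contDiff_norm_sq ℝ)

lemma one_le_radialEigen {n : ℕ} (hn : 1 ≤ n) (x : Space n) : 1 ≤ radialEigen x :=
  one_le_besselSeries (by positivity) (by positivity)

/-- The Laplacian in coordinates. -/
noncomputable def laplace {n : ℕ} (ψ : Space n → ℝ) (x : Space n) : ℝ :=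
  ∑ i, fderiv ℝ (fun y => fderiv ℝ ψ y (EuclideanSpace.single i 1)) x (EuclideanSpace.single i 1)

/-- The Laplacian of `F(‖x‖²)` is `4‖x‖² F'' + 2n F'`; for `ν = n/2` this is the left side of the
equation encoded in `besselSeries_eq`. -/
lemma laplace_radialEigen {n : ℕ} (hn : 1 ≤ n) (x : Space n) :
    laplace radialEigen x = radialEigen x := by
  set ν : ℝ := n / 2 with hνdef
  have hν : 0 < ν := by positivity
  have hν1 : 0 < ν + 1 := by linarith
  have hsq : ∀ y : Space n, HasFDerivAt (fun y : Space n => ‖y‖ ^ 2) (2 • innerSL ℝ y) y :=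
    fun y => (hasStrictFDerivAt_norm_sq y).hasFDerivAt
  have h1 : ∀ (ρ : ℝ), 0 < ρ → ∀ y : Space n, HasFDerivAt (fun y => besselSeries ρ (‖y‖ ^ 2))
      ((besselSeries (ρ + 1) (‖y‖ ^ 2) / (4 * ρ)) • (2 • innerSL ℝ y)) y := fun ρ hρ y =>
    (hasDerivAt_besselSeries hρ _).comp_hasFDerivAt y (hsq y)
  have hterm : ∀ i : Fin n, fderiv ℝ (fun y => fderiv ℝ radialEigen y (EuclideanSpace.single i 1)) x
      (EuclideanSpace.single i 1) =
      4 * (x i) ^ 2 * (besselSeries (ν + 2) (‖x‖ ^ 2) / (16 * ν * (ν + 1)))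
        + 2 * (besselSeries (ν + 1) (‖x‖ ^ 2) / (4 * ν)) := by
    intro i
    have e1 : (fun y : Space n => fderiv ℝ radialEigen y (EuclideanSpace.single i 1)) =
        fun y => besselSeries (ν + 1) (‖y‖ ^ 2) * (y i / (2 * ν)) := by
      funext y
      rw [show radialEigen = fun y : Space n => besselSeries ν (‖y‖ ^ 2) from rfl,
        (h1 ν hν y).fderiv]
      simp [EuclideanSpace.inner_single_right]
      field_simp
      ring
    have e2 : HasFDerivAt (fun y : Space n => y i / (2 * ν))
        ((1 / (2 * ν)) • (EuclideanSpace.proj i : Space n →L[ℝ] ℝ)) x := by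
      have := ((EuclideanSpace.proj i : Space n →L[ℝ] ℝ).hasFDerivAt (x := x)).const_smul
        (1 / (2 * ν))
      refine this.congr_of_eventuallyEq (Eventually.of_forall fun y => ?_)
      simp
      ring
    rw [e1, ((h1 (ν + 1) hν1 x).fun_mul e2).fderiv]
    simp [EuclideanSpace.inner_single_right]
    rw [show ν + 1 + 1 = ν + 2 by ring]
    field_simp
    ring
  rw [laplace, Finset.sum_congr rfl fun i _ => hterm i, Finset.sum_add_distrib, ← Finset.sum_mul,
    ← Finset.mul_sum]
  have hnorm : ∑ i, (x i) ^ 2 = ‖x‖ ^ 2 := by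
    rw [EuclideanSpace.norm_sq_eq]; simp
  rw [hnorm, Finset.sum_const, Finset.card_univ, Fintype.card_fin, nsmul_eq_mul,
    show radialEigen x = besselSeries ν (‖x‖ ^ 2) from rfl, besselSeries_eq hν,
    show (n : ℝ) = 2 * ν by rw [hνdef]; ring]
  field_simp
  ring

/-- In the radial variable, `Δψ = ψ` reads `Y'' + ((n-1)/s) Y' = Y`, so `exists_growth_upper`
applies with `κ = n - 1`. -/
lemma exists_radialEigen_le {n : ℕ} (hn : 1 ≤ n) : ∃ C : ℝ, 0 < C ∧ ∀ s : ℝ, 0 ≤ s →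
    besselSeries (n / 2) (s ^ 2) ≤ C * ((1 + s) ^ (-(((n : ℝ) - 1) / 2)) * Real.exp s) := by
  obtain ⟨ν, hνdef⟩ : ∃ ν : ℝ, ν = n / 2 := ⟨_, rfl⟩
  have hn' : (1 : ℝ) ≤ n := by exact_mod_cast hn
  have hν : 0 < ν := by rw [hνdef]; positivity
  have hν1 : 0 < ν + 1 := by linarith
  have hd : ∀ ρ, 0 < ρ → ∀ s : ℝ, HasDerivAt (fun s => besselSeries ρ (s ^ 2))
      (besselSeries (ρ + 1) (s ^ 2) / (4 * ρ) * (2 * s)) s := fun ρ hρ s => by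
    refine ((hasDerivAt_besselSeries hρ (s ^ 2)).comp s (hasDerivAt_pow 2 s)).congr_deriv ?_
    simp
  rw [← hνdef]
  refine exists_growth_upper (κ := (n : ℝ) - 1) (Y := fun s => besselSeries ν (s ^ 2))
    (Z := fun s => besselSeries (ν + 1) (s ^ 2) * (s / (2 * ν))) (by linarith)
    (((contDiff_besselSeries hν).continuous).comp (by fun_prop)) (fun s _ => ?_) (fun s hs => ?_)
    (fun s _ => (zero_le_one.trans (one_le_besselSeries hν (sq_nonneg s))))
    (fun s hs => mul_nonneg (zero_le_one.trans (one_le_besselSeries hν1 (sq_nonneg s)))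
      (by positivity))
  · refine (hd ν hν s).congr_deriv ?_
    field_simp
    ring
  · refine ((hd (ν + 1) hν1 s).fun_mul ((hasDerivAt_id s).div_const (2 * ν))).congr_deriv ?_
    rw [besselSeries_eq hν, show (n : ℝ) = 2 * ν by rw [hνdef]; ring,
      show ν + 1 + 1 = ν + 2 by ring]
    simp only [id]
    field_simp
    ring

/-! ### Integrals of powers of the radial eigenfunction over balls -/

lemma exists_rpow_le_exp (a : ℝ) {b : ℝ} (hb : 0 < b) : ∃ C : ℝ, 0 < C ∧
    ∀ w : ℝ, 0 ≤ w → (1 + w) ^ a ≤ C * Real.exp (b * w) := by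
  set a' : ℝ := |a| + 1 with ha'
  have ha0 : 0 < a' := by positivity
  have haa : a ≤ a' := by linarith [le_abs_self a]
  have hC : 0 < max 1 (a' / b) := by positivity
  refine ⟨max 1 (a' / b) ^ a', Real.rpow_pos_of_pos hC _, fun w hw => ?_⟩
  have h1 : 1 + w ≤ max 1 (a' / b) * Real.exp (b * w / a') := by
    have e1 := Real.add_one_le_exp (b * w / a')
    have e2 : w = a' / b * (b * w / a') := by field_simp
    have e3 : 0 ≤ b * w / a' := by positivity
    have e4 : w ≤ max 1 (a' / b) * (b * w / a') := by
      nth_rw 1 [e2]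
      exact mul_le_mul_of_nonneg_right (le_max_right _ _) e3
    have e5 := mul_le_mul_of_nonneg_left e1 hC.le
    have e6 := le_max_left 1 (a' / b)
    linarith
  calc (1 + w) ^ a ≤ (1 + w) ^ a' := Real.rpow_le_rpow_of_exponent_le (by linarith) haa
    _ ≤ (max 1 (a' / b) * Real.exp (b * w / a')) ^ a' :=
      Real.rpow_le_rpow (by linarith) h1 ha0.le
    _ = _ := by
      rw [Real.mul_rpow hC.le (Real.exp_pos _).le, ← Real.exp_mul]
      congr 2
      field_simp

/-- Peetre's inequality, from `1 + X ≤ (1 + (X - y))(1 + y)`. It freezes a power of either sign at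
the boundary radius, where the exponential concentrates the integral. -/
lemma rpow_le_rpow_mul_of_le (Q : ℝ) {X y : ℝ} (hy : 0 ≤ y) (hyX : y ≤ X) :
    (1 + y) ^ Q ≤ (1 + X) ^ Q * (1 + (X - y)) ^ |Q| := by
  have h1 : 0 < 1 + y := by linarith
  have h2 : 0 < 1 + X := by linarith
  rcases le_total 0 Q with hQ | hQ
  · have a1 := Real.rpow_le_rpow h1.le (by linarith : 1 + y ≤ 1 + X) hQ
    have a2 : 1 ≤ (1 + (X - y)) ^ |Q| := Real.one_le_rpow (by linarith) (abs_nonneg Q)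
    exact a1.trans (le_mul_of_one_le_right (Real.rpow_nonneg h2.le _) a2)
  · obtain ⟨P, rfl⟩ : ∃ P, Q = -P := ⟨-Q, by ring⟩
    have hP : 0 ≤ P := by linarith
    rw [abs_neg, abs_of_nonneg hP, Real.rpow_neg h1.le, Real.rpow_neg h2.le]
    have a1 : (1 + X) ^ P ≤ (1 + (X - y)) ^ P * (1 + y) ^ P := by
      rw [← Real.mul_rpow (by linarith) h1.le]
      exact Real.rpow_le_rpow h2.le (by nlinarith) hP
    have b1 := Real.rpow_pos_of_pos h1 P
    have b2 := Real.rpow_pos_of_pos h2 P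
    rw [inv_mul_eq_div, le_div_iff₀ b2, inv_mul_eq_div, div_le_iff₀ b1]
    linarith

/-- The growth of the powers of `radialEigen` on balls. -/
theorem exists_integral_radialEigen_le {n : ℕ} (hn : 1 ≤ n) {q : ℝ} (hq : 0 < q) :
    ∃ C : ℝ, 0 < C ∧ ∀ X : ℝ, 0 ≤ X →
      ∫ x in Metric.closedBall (0 : Space n) X, radialEigen x ^ q ≤
        C * ((1 + X) ^ (((n : ℝ) - 1) * (1 - q / 2)) * Real.exp (q * X)) := by
  have : Nonempty (Fin n) := ⟨⟨0, hn⟩⟩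
  set Q : ℝ := ((n : ℝ) - 1) * (1 - q / 2) with hQ
  obtain ⟨C₁, hC₁, H₁⟩ := exists_radialEigen_le hn
  obtain ⟨C₂, hC₂, H₂⟩ := exists_rpow_le_exp |Q| (b := q / 2) (by positivity)
  set V : ℝ := n * (volume : Measure (Space n)).real (Metric.ball 0 1) with hV
  have hV0 : 0 ≤ V := by positivity
  set D : ℝ := C₁ ^ q * C₂ * (2 / q) with hD
  have hD0 : 0 < D := by have := Real.rpow_pos_of_pos hC₁ q; positivity
  refine ⟨(V + 1) * D, by positivity, fun X hX => ?_⟩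
  have hνp : (0 : ℝ) < n / 2 := by positivity
  have hFc : Continuous fun y : ℝ => y ^ (n - 1) * besselSeries (n / 2) (y ^ 2) ^ q := by
    have : Continuous fun y : ℝ => besselSeries (n / 2) (y ^ 2) :=
      (contDiff_besselSeries hνp).continuous.comp (by fun_prop)
    exact (continuous_pow _).mul (this.rpow_const fun x => Or.inl
      (one_pos.trans_le (one_le_besselSeries hνp (sq_nonneg x))).ne')
  have h1X : 0 < 1 + X := by linarith
  have hXQ := Real.rpow_pos_of_pos h1X Q
  have hpolar : ∫ x in Metric.closedBall (0 : Space n) X, radialEigen x ^ q =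
      V * ∫ y in (0 : ℝ)..X, y ^ (n - 1) * besselSeries (n / 2) (y ^ 2) ^ q := by
    rw [← integral_indicator measurableSet_closedBall]
    have := integral_fun_norm_addHaar (volume : Measure (Space n))
      ((Set.Iic X).indicator fun y : ℝ => besselSeries (n / 2) (y ^ 2) ^ q)
    rw [finrank_euclideanSpace_fin, nsmul_eq_mul, smul_eq_mul, ← mul_assoc] at this
    rw [intervalIntegral.integral_of_le hX, ← Set.Ioi_inter_Iic,
      ← setIntegral_indicator measurableSet_Iic]
    convert this using 1
    · congr 1
      funext x
      simp [Set.indicator, radialEigen]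
    · congr 2
      funext y
      simp [Set.indicator]
  -- Moving the power from `y` to `X` costs `(1 + (X - y))^|Q|`. This is absorbed by `e^(q(X-y)/2)`,
  -- which leaves the integrable factor `e^(qy/2)`.
  have hint : ∫ y in (0 : ℝ)..X, y ^ (n - 1) * besselSeries (n / 2) (y ^ 2) ^ q ≤
      ∫ y in (0 : ℝ)..X,
        C₁ ^ q * C₂ * (1 + X) ^ Q * Real.exp (q / 2 * X) * Real.exp (q / 2 * y) := by
    refine intervalIntegral.integral_mono_on hX (hFc.intervalIntegrable _ _)
      ((by fun_prop : Continuous _).intervalIntegrable _ _) fun y hy => ?_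
    have hy1 : 0 < 1 + y := by linarith [hy.1]
    have a1 : y ^ (n - 1) ≤ (1 + y) ^ ((n : ℝ) - 1) := by
      rw [show (n : ℝ) - 1 = ((n - 1 : ℕ) : ℝ) by push_cast [hn]; ring, Real.rpow_natCast]
      exact pow_le_pow_left₀ hy.1 (by linarith) _
    have a2 : besselSeries (n / 2) (y ^ 2) ^ q ≤
        C₁ ^ q * ((1 + y) ^ (-(((n : ℝ) - 1) / 2) * q) * Real.exp (q * y)) := by
      have b0 : 0 ≤ (1 + y) ^ (-(((n : ℝ) - 1) / 2)) := Real.rpow_nonneg hy1.le _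
      calc _ ≤ (C₁ * ((1 + y) ^ (-(((n : ℝ) - 1) / 2)) * Real.exp y)) ^ q :=
            Real.rpow_le_rpow (zero_le_one.trans (one_le_besselSeries hνp (sq_nonneg y)))
              (H₁ y hy.1) hq.le
        _ = _ := by
          rw [Real.mul_rpow hC₁.le (by positivity), Real.mul_rpow b0 (Real.exp_pos _).le,
            ← Real.rpow_mul hy1.le, ← Real.exp_mul, mul_comm y q]
    have a3 : (1 + y) ^ ((n : ℝ) - 1) * (1 + y) ^ (-(((n : ℝ) - 1) / 2) * q) = (1 + y) ^ Q := by
      rw [← Real.rpow_add hy1]; congr 1; rw [hQ]; ring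
    have a4 := rpow_le_rpow_mul_of_le Q hy.1 hy.2
    have a5 := H₂ (X - y) (by linarith [hy.2])
    have hC₁q := Real.rpow_pos_of_pos hC₁ q
    calc _ ≤ (1 + y) ^ ((n : ℝ) - 1) *
          (C₁ ^ q * ((1 + y) ^ (-(((n : ℝ) - 1) / 2) * q) * Real.exp (q * y))) :=
          mul_le_mul a1 a2 (Real.rpow_nonneg
            (zero_le_one.trans (one_le_besselSeries hνp (sq_nonneg y))) _)
            (Real.rpow_nonneg hy1.le _)
      _ = C₁ ^ q * ((1 + y) ^ Q * Real.exp (q * y)) := by rw [← a3]; ring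
      _ ≤ C₁ ^ q * ((1 + X) ^ Q * (C₂ * Real.exp (q / 2 * (X - y))) * Real.exp (q * y)) := by
          gcongr
          exact a4.trans (by gcongr)
      _ = C₁ ^ q * C₂ * (1 + X) ^ Q * (Real.exp (q / 2 * (X - y)) * Real.exp (q * y)) := by ring
      _ = C₁ ^ q * C₂ * (1 + X) ^ Q * (Real.exp (q / 2 * X) * Real.exp (q / 2 * y)) := by
          rw [← Real.exp_add, ← Real.exp_add]; congr 2; ring
      _ = _ := by ring
  have hexp : ∫ y in (0 : ℝ)..X, Real.exp (q / 2 * y) ≤ 2 / q * Real.exp (q / 2 * X) := by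
    rw [intervalIntegral.integral_comp_mul_left _ (by positivity : q / 2 ≠ 0), integral_exp]
    simp only [smul_eq_mul, mul_zero, Real.exp_zero, inv_div]
    gcongr
    linarith
  rw [hpolar]
  calc V * ∫ y in (0 : ℝ)..X, y ^ (n - 1) * besselSeries (n / 2) (y ^ 2) ^ q
      ≤ V * (C₁ ^ q * C₂ * (1 + X) ^ Q * Real.exp (q / 2 * X) * (2 / q * Real.exp (q / 2 * X))) := by
        gcongr
        refine hint.trans ?_
        rw [intervalIntegral.integral_const_mul]
        have := Real.rpow_pos_of_pos hC₁ q
        gcongr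
    _ = V * (D * ((1 + X) ^ Q * Real.exp (q * X))) := by
        rw [show q * X = q / 2 * X + q / 2 * X by ring, Real.exp_add, hD]; ring
    _ ≤ (V + 1) * (D * ((1 + X) ^ Q * Real.exp (q * X))) := by gcongr; linarith
    _ = _ := by ring

/-! ### Averages of energy solutions -/

lemma exists_gt_mem_timeInterval {T : ℝ≥0∞} {t : ℝ} (ht : t ∈ timeInterval T) :
    ∃ t', t < t' ∧ t' ∈ timeInterval T := by
  obtain ⟨r, hr, h1, h2⟩ := ENNReal.lt_iff_exists_real_btwn.1 ht.2
  exact ⟨r, (ENNReal.ofReal_lt_ofReal_iff_of_nonneg ht.1).1 h1, hr, h2⟩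

lemma Icc_subset_timeInterval {T : ℝ≥0∞} {t : ℝ} (ht : t ∈ timeInterval T) :
    Set.Icc 0 t ⊆ timeInterval T := fun _ hs =>
  ⟨hs.1, (ENNReal.ofReal_le_ofReal hs.2).trans_lt ht.2⟩

/-- Integration by parts against a test function. -/
lemma integral_inner_gradient {n : ℕ} {w : Space n → ℝ} {G : Space n → Space n}
    (hw : MemLp w 2 volume) (hG : MemLp G 2 volume) (h : HasWeakGradient w G) {Φ : Space n → ℝ}
    (hΦ : ContDiff ℝ ∞ Φ) (hc : HasCompactSupport Φ) :
    ∫ x, inner ℝ (G x) (gradient Φ x) = - ∫ x, w x * laplace Φ x := by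
  set e : Fin n → Space n := fun i => EuclideanSpace.single i 1 with he
  set D : Fin n → Space n → ℝ := fun i x => fderiv ℝ Φ x (e i) with hD
  have hDs : ∀ i, ContDiff ℝ ∞ (D i) := fun i =>
    (hΦ.fderiv_right (m := ∞) (by simp)).clm_apply contDiff_const
  have hDc : ∀ i, HasCompactSupport (D i) := fun i => hc.fderiv_apply ℝ (e i)
  have hDDs : ∀ i, Continuous fun x => fderiv ℝ (D i) x := fun i =>
    ((hDs i).fderiv_right (m := ∞) (by simp)).continuous
  have hwl := hw.locallyIntegrable (by norm_num)
  have hGl := hG.locallyIntegrable (by norm_num)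
  have hDG : ∀ i, Integrable fun x => D i x • G x := fun i =>
    hGl.integrable_smul_left_of_hasCompactSupport (hDs i).continuous (hDc i)
  have hgradc : ∀ i, Continuous fun x => gradient (D i) x := fun i =>
    (InnerProductSpace.toDual ℝ (Space n)).symm.continuous.comp (hDDs i)
  have hwD : ∀ i, Integrable fun x => w x • gradient (D i) x := fun i => by
    refine hwl.integrable_smul_right_of_hasCompactSupport (hgradc i) ?_
    refine ((hDc i).fderiv (𝕜 := ℝ)).comp_left (map_zero _)
  -- The weak gradient is tested with the partial derivative `D i` of `Φ`, and only the `i`-th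
  -- coordinate of the vector identity is kept.
  have key : ∀ i, ∫ x, w x * fderiv ℝ (D i) x (e i) = - ∫ x, D i x * G x i := by
    intro i
    have h1 := congrArg (EuclideanSpace.proj i : Space n →L[ℝ] ℝ) (h (D i) (hDs i) (hDc i))
    rw [map_neg, ← ContinuousLinearMap.integral_comp_comm _ (hwD i),
      ← ContinuousLinearMap.integral_comp_comm _ (hDG i)] at h1
    have h2 : ∀ x, (EuclideanSpace.proj i : Space n →L[ℝ] ℝ) (w x • gradient (D i) x) =
        w x * fderiv ℝ (D i) x (e i) := fun x => by
      rw [← inner_gradient_left, he, EuclideanSpace.inner_single_right]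
      simp
    have h3 : ∀ x, (EuclideanSpace.proj i : Space n →L[ℝ] ℝ) (D i x • G x) = D i x * G x i :=
      fun x => by simp
    simp only [h2, h3] at h1
    exact h1
  have hwDi : ∀ i, Integrable fun x => w x * fderiv ℝ (D i) x (e i) := fun i => by
    refine ((hwD i).inner_const (𝕜 := ℝ) (e i)).congr (Eventually.of_forall fun x => ?_)
    simp [inner_smul_left, inner_gradient_left]
  have hDGi : ∀ i, Integrable fun x => D i x * G x i := fun i => by
    refine ((hDG i).inner_const (𝕜 := ℝ) (e i)).congr (Eventually.of_forall fun x => ?_)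
    simp [inner_smul_left, he, EuclideanSpace.inner_single_right]
  have h2 : ∀ x, inner ℝ (G x) (gradient Φ x) = ∑ i, D i x * G x i := by
    intro x
    rw [real_inner_comm, inner_gradient_left]
    conv_lhs => rw [← (EuclideanSpace.basisFun (Fin n) ℝ).sum_repr (G x)]
    simp [hD, he, mul_comm]
  have h3 : ∀ x, w x * laplace Φ x = ∑ i, w x * fderiv ℝ (D i) x (e i) := by
    intro x
    rw [laplace, Finset.mul_sum]
  simp_rw [h2, h3]
  rw [integral_finsetSum _ fun i _ => hDGi i, integral_finsetSum _ fun i _ => hwDi i,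
    ← Finset.sum_neg_distrib]
  exact Finset.sum_congr rfl fun i _ => by rw [key, neg_neg]

/-- Weighted integrals of `|w_s| ^ p` are continuous if `w` is so in `L ^ p`. -/
lemma continuousAt_integral_rpow {α : Type*} [MeasurableSpace α] {ν : Measure α} {p : ℝ}
    (hp : 1 < p) {w : ℝ → α → ℝ} {Φ : α → ℝ} {c t : ℝ} (hΦm : Measurable Φ) (hΦ0 : ∀ x, 0 ≤ Φ x)
    (hΦc : ∀ x, Φ x ≤ c) (hw : ∀ᶠ s in 𝓝 t, MemLp (w s) (ENNReal.ofReal p) ν)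
    (hlim : Tendsto (fun s => eLpNorm (fun x => w s x - w t x) (ENNReal.ofReal p) ν) (𝓝 t) (𝓝 0)) :
    ContinuousAt (fun s => ∫ x, |w s x| ^ p * Φ x ∂ν) t := by
  have hp0 : 0 < p := by linarith
  set q := ENNReal.ofReal p with hq
  have hq1 : 1 ≤ q := by rw [hq, ← ENNReal.ofReal_one]; exact ENNReal.ofReal_le_ofReal hp.le
  -- With the weight split as `(Φ^(1/p))^p`, the integral becomes the `p`-th power of an `L^p` norm,
  -- whose continuity follows from the triangle inequality.
  set W : ℝ → α → ℝ := fun s x => Φ x ^ p⁻¹ * w s x with hW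
  have hΦr : ∀ x, ‖Φ x ^ p⁻¹‖ ≤ c ^ p⁻¹ := fun x => by
    rw [Real.norm_of_nonneg (Real.rpow_nonneg (hΦ0 x) _)]
    exact Real.rpow_le_rpow (hΦ0 x) (hΦc x) (by positivity)
  have hΦrm : AEStronglyMeasurable (fun x => Φ x ^ p⁻¹) ν :=
    (hΦm.pow_const _).aestronglyMeasurable
  have hWm : ∀ s, MemLp (w s) q ν → MemLp (W s) q ν := fun s hs =>
    hs.of_le_mul (hΦrm.mul hs.1) (c := c ^ p⁻¹) (Eventually.of_forall fun x => by
      rw [hW, norm_mul]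
      exact mul_le_mul_of_nonneg_right (hΦr x) (norm_nonneg _))
  set δ : ℝ → ℝ≥0∞ := fun s => eLpNorm (W s - W t) q ν with hδ
  have hδlim : Tendsto δ (𝓝 t) (𝓝 0) := by
    refine tendsto_of_tendsto_of_tendsto_of_le_of_le tendsto_const_nhds
      (h := fun s => ENNReal.ofReal (c ^ p⁻¹) * eLpNorm (fun x => w s x - w t x) q ν) ?_
      (fun _ => zero_le) (fun s => ?_)
    · simpa using ENNReal.Tendsto.const_mul hlim (Or.inr ENNReal.ofReal_ne_top)
    · refine eLpNorm_le_mul_eLpNorm_of_ae_le_mul (Eventually.of_forall fun x => ?_) _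
      simp only [hW, Pi.sub_apply]
      rw [← mul_sub, norm_mul]
      exact mul_le_mul_of_nonneg_right (hΦr x) (norm_nonneg _)
  have htm := hWm t hw.self_of_nhds
  have hN : Tendsto (fun s => eLpNorm (W s) q ν) (𝓝 t) (𝓝 (eLpNorm (W t) q ν)) := by
    have hup : Tendsto (fun s => eLpNorm (W t) q ν + δ s) (𝓝 t) (𝓝 (eLpNorm (W t) q ν)) := by
      simpa using (tendsto_const_nhds (x := eLpNorm (W t) q ν)).add hδlim
    have hdn : Tendsto (fun s => eLpNorm (W t) q ν - δ s) (𝓝 t) (𝓝 (eLpNorm (W t) q ν)) := by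
      simpa using ENNReal.Tendsto.sub (tendsto_const_nhds (x := eLpNorm (W t) q ν)) hδlim
        (Or.inl htm.eLpNorm_ne_top)
    refine tendsto_of_tendsto_of_tendsto_of_le_of_le' hdn hup ?_ ?_
    · filter_upwards [hw] with s hs
      rw [tsub_le_iff_right]
      have h1 := eLpNorm_sub_le (hWm s hs).1 ((hWm s hs).1.sub htm.1) hq1
      rwa [sub_sub_cancel] at h1
    · filter_upwards [hw] with s hs
      have h1 := eLpNorm_add_le htm.1 ((hWm s hs).1.sub htm.1) hq1
      rwa [add_sub_cancel] at h1
  have hval : ∀ s, MemLp (w s) q ν →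
      ∫ x, |w s x| ^ p * Φ x ∂ν = (eLpNorm (W s) q ν).toReal ^ p := by
    intro s hs
    have hpt : ∀ x, ‖W s x‖ ^ p = |w s x| ^ p * Φ x := by
      intro x
      rw [hW, norm_mul, Real.norm_of_nonneg (Real.rpow_nonneg (hΦ0 x) _),
        Real.mul_rpow (Real.rpow_nonneg (hΦ0 x) _) (norm_nonneg _), ← Real.rpow_mul (hΦ0 x),
        inv_mul_cancel₀ hp0.ne', Real.rpow_one, mul_comm, Real.norm_eq_abs]
    have hint : 0 ≤ ∫ x, |w s x| ^ p * Φ x ∂ν :=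
      integral_nonneg fun x => mul_nonneg (Real.rpow_nonneg (abs_nonneg _) _) (hΦ0 x)
    rw [(hWm s hs).eLpNorm_eq_integral_rpow_norm (by positivity) ENNReal.ofReal_ne_top,
      ENNReal.toReal_ofReal hp0.le]
    simp_rw [hpt]
    rw [ENNReal.toReal_ofReal (Real.rpow_nonneg hint _), ← Real.rpow_mul hint,
      inv_mul_cancel₀ hp0.ne', Real.rpow_one]
  have h1 : Tendsto (fun s => (eLpNorm (W s) q ν).toReal ^ p) (𝓝 t)
      (𝓝 ((eLpNorm (W t) q ν).toReal ^ p)) :=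
    ((ENNReal.tendsto_toReal htm.eLpNorm_ne_top).comp hN).rpow_const (Or.inr hp0.le)
  rw [ContinuousAt, hval t hw.self_of_nhds]
  refine h1.congr' ?_
  filter_upwards [hw] with s hs
  rw [hval s hs]

lemma laplace_congr {n : ℕ} {Φ ψ : Space n → ℝ} {x : Space n} (h : Φ =ᶠ[𝓝 x] ψ) :
    laplace Φ x = laplace ψ x := by
  refine Finset.sum_congr rfl fun i _ => ?_
  have : (fun y => fderiv ℝ Φ y (EuclideanSpace.single i 1)) =ᶠ[𝓝 x]
      fun y => fderiv ℝ ψ y (EuclideanSpace.single i 1) := by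
    filter_upwards [h.fderiv (𝕜 := ℝ)] with y hy
    rw [hy]
  rw [this.fderiv_eq]

/-- Integration against a square integrable function, as a functional on `L²`. -/
lemma exists_clm_integral {n : ℕ} {Φ : Space n → ℝ} (hΦ : MemLp Φ 2 volume) :
    ∃ Λ : Lp ℝ 2 (volume : Measure (Space n)) →L[ℝ] ℝ, ∀ w : Lp ℝ 2 (volume : Measure (Space n)),
      Λ w = ∫ x, w x * Φ x := by
  refine ⟨innerSL ℝ (hΦ.toLp Φ), fun w => ?_⟩
  rw [innerSL_apply_apply, L2.inner_def]
  refine integral_congr_ae ?_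
  filter_upwards [hΦ.coeFn_toLp] with x hx
  simp [hx]

/-- The weighted averages of an energy solution solve an ordinary differential equation. -/
theorem IsEnergySolution.dampedODE {n : ℕ} {μ p ε R : ℝ} {f g : Space n → ℝ} {T : ℝ≥0∞}
    {u v : ℝ → Lp ℝ 2 (volume : Measure (Space n))}
    {G : ℝ → Lp (Space n) 2 (volume : Measure (Space n))}
    (h : IsEnergySolution μ p ε f g T u v G) (hp : 1 < p) (hR : 1 ≤ R)
    (hcone : SupportedInCone R T u) {t₁ : ℝ} (ht₁ : 0 < t₁) (hT : t₁ ∈ timeInterval T)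
    {ψ : Space n → ℝ} (hψ : ContDiff ℝ ∞ ψ) (hψ0 : ∀ x, 0 ≤ ψ x) {l : ℝ}
    (hl : ∀ x, laplace ψ x = l * ψ x)
    {m : ℝ} (hfg : ∀ᵐ x, m * f x + g x = 0) :
    ∃ Y Z r : ℝ → ℝ, DampedODE μ l (1 + t₁) Y Z r ∧
      Y 1 = ε * ∫ x in Metric.closedBall 0 R, f x * ψ x ∧ Z 1 = -(m * Y 1) ∧
      (∀ s ∈ Set.Icc 1 (1 + t₁),
        Y s = ∫ x in Metric.closedBall 0 (s - 1 + R), u (s - 1) x * ψ x) ∧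
      ∀ s ∈ Set.Ioc 1 (1 + t₁),
        r s = ∫ x in Metric.closedBall 0 (s - 1 + R), |u (s - 1) x| ^ p * ψ x := by
  -- The room between `t₁` and `t₂ < T` lets `η` equal `1` near `[0, t₁]`, so the time derivative of
  -- the test function vanishes there. Likewise `χ` equals `1` near the support of `u(t)` for `t ≤
  -- t₁`, so the cutoff is invisible to `u` and to the Laplacian tested against it.
  obtain ⟨t₂, ht₂, hT₂⟩ := exists_gt_mem_timeInterval hT
  set χ : ContDiffBump (0 : Space n) := ⟨t₁ + R + 1, t₁ + R + 2, by linarith, by linarith⟩ with hχ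
  set η : ContDiffBump (0 : ℝ) := ⟨(t₁ + t₂) / 2, t₂, by linarith, by linarith⟩ with hη
  set K : Set (Space n) := Metric.closedBall 0 (t₁ + R + 2) with hK
  have hKc : IsCompact K := isCompact_closedBall _ _
  set Φ : Space n → ℝ := fun x => χ x * ψ x with hΦ
  have hΦs : ContDiff ℝ ∞ Φ := (χ.contDiff (n := ⊤)).mul hψ
  have hχ0 : ∀ x, x ∉ K → χ x = 0 := fun x hx => by
    refine χ.zero_of_le_dist ?_
    have : ¬ dist x 0 ≤ t₁ + R + 2 := hx
    exact (not_le.1 this).le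
  have hΦK : ∀ x, x ∉ K → Φ x = 0 := fun x hx => by simp [hΦ, hχ0 x hx]
  have hΦc : HasCompactSupport Φ := HasCompactSupport.intro hKc hΦK
  have hΦ0 : ∀ x, 0 ≤ Φ x := fun x => mul_nonneg χ.nonneg (hψ0 x)
  have hχ1 : ∀ x : Space n, ‖x‖ ≤ t₁ + R + 1 → χ x = 1 := fun x hx =>
    χ.one_of_mem_closedBall (by simpa [hχ] using hx)
  have hη1 : ∀ s : ℝ, |s| ≤ (t₁ + t₂) / 2 → η s = 1 := fun s hs =>
    η.one_of_mem_closedBall (by simpa [hη] using hs)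
  obtain ⟨c, hc⟩ : ∃ c, ∀ x, Φ x ≤ c := by
    obtain ⟨c, hc⟩ := hΦc.exists_bound_of_continuous hΦs.continuous
    exact ⟨c, fun x => (le_abs_self _).trans (hc x)⟩
  have hΦmem : MemLp Φ 2 volume := hΦs.continuous.memLp_of_hasCompactSupport hΦc
  obtain ⟨Λ, hΛ⟩ := exists_clm_integral hΦmem
  have hcone' : ∀ t ∈ Set.Icc 0 t₁, ∀ᵐ x, t + R < ‖x‖ → u t x = 0 := fun t ht =>
    hcone t (Icc_subset_timeInterval hT ht)
  have hball : ∀ t ∈ Set.Icc 0 t₁, ∀ F : ℝ → ℝ, F 0 = 0 →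
      ∫ x, F (u t x) * Φ x = ∫ x in Metric.closedBall 0 (t + R), F (u t x) * ψ x := by
    intro t ht F hF
    rw [← integral_indicator measurableSet_closedBall]
    refine integral_congr_ae ?_
    filter_upwards [hcone' t ht] with x hx
    by_cases hxt : ‖x‖ ≤ t + R
    · rw [Set.indicator_of_mem (by simpa using hxt)]
      simp only [hΦ]
      rw [hχ1 x (by linarith [ht.2]), one_mul]
    · rw [Set.indicator_of_notMem (by simpa using hxt), hx (not_le.1 hxt), hF, zero_mul]
  set φ : Space n × ℝ → ℝ := fun z => Φ z.1 * η z.2 with hφ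
  have htest : IsTestFunction T φ := by
    have hz : ∀ z : Space n × ℝ, z ∉ K ×ˢ Metric.closedBall (0 : ℝ) t₂ → φ z = 0 := by
      intro z hz
      rw [Set.mem_prod, not_and_or] at hz
      rcases hz with hz | hz
      · simp only [hφ]; rw [hΦK _ hz, zero_mul]
      · have : η z.2 = 0 := η.zero_of_le_dist (by
          have : ¬ dist z.2 0 ≤ t₂ := hz
          exact (not_le.1 this).le)
        simp only [hφ]; rw [this, mul_zero]
    refine ⟨(hΦs.comp contDiff_fst).mul ((η.contDiff (n := ⊤)).comp contDiff_snd),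
      HasCompactSupport.intro (hKc.prod (isCompact_closedBall _ _)) hz, fun z hz' => ?_⟩
    have hsub : tsupport φ ⊆ K ×ˢ Metric.closedBall (0 : ℝ) t₂ :=
      closure_minimal (fun x hx => by_contra fun hx' => hx (hz x hx'))
        (hKc.prod (isCompact_closedBall _ _)).isClosed
    have h2 : dist z.2 0 ≤ t₂ := (hsub hz').2
    rw [Real.dist_eq, sub_zero] at h2
    exact (ENNReal.ofReal_le_ofReal ((le_abs_self _).trans h2)).trans_lt hT₂.2
  have hηI : ∀ s ∈ Set.Icc 0 t₁, η s = 1 := fun s hs =>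
    hη1 s (by rw [abs_of_nonneg hs.1]; linarith [hs.2])
  have hφI : ∀ s ∈ Set.Icc 0 t₁, ∀ x, φ (x, s) = Φ x := fun s hs x => by
    simp only [hφ]; rw [hηI s hs, mul_one]
  have hφd : ∀ s ∈ Set.Icc 0 t₁, ∀ x, deriv (fun τ => φ (x, τ)) s = 0 := fun s hs x => by
    have : (fun τ => φ (x, τ)) =ᶠ[𝓝 s] fun _ => Φ x := by
      have hmem : Metric.closedBall (0 : ℝ) ((t₁ + t₂) / 2) ∈ 𝓝 s := by
        refine mem_of_superset (Metric.isOpen_ball.mem_nhds ?_) Metric.ball_subset_closedBall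
        rw [mem_ball_zero_iff, Real.norm_of_nonneg hs.1]
        linarith [hs.2]
      filter_upwards [hmem] with τ hτ
      have : |τ| ≤ (t₁ + t₂) / 2 := by simpa using hτ
      simp only [hφ]
      rw [hη1 τ this, mul_one]
    rw [this.deriv_eq, deriv_const]
  set Y₀ : ℝ → ℝ := fun t => ∫ x, u t x * Φ x with hY₀
  set Z₀ : ℝ → ℝ := fun t => ∫ x, v t x * Φ x with hZ₀
  set r₀ : ℝ → ℝ := fun t => ∫ x, |u t x| ^ p * Φ x with hr₀
  have hI : Set.Icc 0 t₁ ⊆ timeInterval T := Icc_subset_timeInterval hT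
  have hYΛ : Y₀ = fun t => Λ (u t) := funext fun t => (hΛ _).symm
  have hZΛ : Z₀ = fun t => Λ (v t) := funext fun t => (hΛ _).symm
  have hYc : ContinuousOn Y₀ (Set.Icc 0 t₁) := by
    rw [hYΛ]; exact Λ.continuous.comp_continuousOn (h.continuous_u.mono hI)
  have hZc : ContinuousOn Z₀ (Set.Icc 0 t₁) := by
    rw [hZΛ]; exact Λ.continuous.comp_continuousOn (h.continuous_v.mono hI)
  have hYd : ∀ t ∈ Set.Ioo 0 t₁, HasDerivAt Y₀ (Z₀ t) t := by
    intro t ht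
    have h1 : HasDerivAt u (v t) t := (h.hasDeriv t (hI (Set.Ioo_subset_Icc_self ht))).hasDerivAt
      (mem_of_superset (Icc_mem_nhds ht.1 ht.2) hI)
    rw [hYΛ, hZΛ]
    exact Λ.hasFDerivAt.comp_hasDerivAt t h1
  have hgrad : ∀ t ∈ Set.Icc 0 t₁, ∫ x, inner ℝ (G t x) (gradient Φ x) = - (l * Y₀ t) := by
    intro t ht
    rw [integral_inner_gradient (Lp.memLp (u t)) (Lp.memLp (G t)) (h.weak_gradient t (hI ht)) hΦs
      hΦc, hY₀, ← integral_const_mul]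
    congr 1
    refine integral_congr_ae ?_
    filter_upwards [hcone' t ht] with x hx
    by_cases hxt : t + R < ‖x‖
    · simp [hx hxt]
    · have hxlt : ‖x‖ < t₁ + R + 1 := by linarith [ht.2, not_lt.1 hxt]
      have hev : Φ =ᶠ[𝓝 x] ψ := by
        filter_upwards [Metric.isOpen_ball.mem_nhds (mem_ball_zero_iff.2 hxlt)] with y hy
        simp only [hΦ]
        rw [hχ1 y (mem_ball_zero_iff.1 hy).le, one_mul]
      rw [laplace_congr hev, hl, ← hev.eq_of_nhds]
      ring
  have hrint : ∀ t ∈ Set.Icc 0 t₁, IntervalIntegrable r₀ volume 0 t := by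
    intro t ht
    refine (h.integrable_nonlinearity φ htest t (hI ht)).congr fun s hs => ?_
    have hs' : s ∈ Set.Icc 0 t₁ := by
      rw [Set.uIoc_of_le ht.1] at hs
      exact ⟨hs.1.le, hs.2.trans ht.2⟩
    simp only [hφI s hs', hr₀]
  have hZint : ∀ t ∈ Set.Icc 0 t₁,
      Z₀ t = Z₀ 0 + ∫ s in (0 : ℝ)..t, (l * Y₀ s + r₀ s - μ / (1 + s) * Z₀ s) := by
    intro t ht
    have hsub : ∀ s ∈ Set.uIcc 0 t, s ∈ Set.Icc 0 t₁ := fun s hs => by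
      rw [Set.uIcc_of_le ht.1] at hs
      exact ⟨hs.1, hs.2.trans ht.2⟩
    have he := h.energy_identity φ htest t (hI ht)
    have e1 : ∫ x, v t x * φ (x, t) = Z₀ t := by simp only [hφI t ht, hZ₀]
    have e2 : ∫ x, ε * g x * φ (x, 0) = Z₀ 0 := by
      refine integral_congr_ae ?_
      filter_upwards [h.initial_v] with x hx
      rw [hφI 0 ⟨le_rfl, ht₁.le⟩, hx]
    have e3 : (∫ s in (0 : ℝ)..t, ∫ x, (-(v s x) * deriv (fun τ => φ (x, τ)) s
            + inner ℝ (G s x) (gradient (fun y => φ (y, s)) x)))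
        = ∫ s in (0 : ℝ)..t, -(l * Y₀ s) := by
      refine intervalIntegral.integral_congr fun s hs => ?_
      have hs' := hsub s hs
      have hfun : (fun y => φ (y, s)) = Φ := funext (hφI s hs')
      simp only [hφd s hs', hfun, mul_zero, zero_add]
      exact hgrad s hs'
    have e4 : (∫ s in (0 : ℝ)..t, ∫ x, μ / (1 + s) * v s x * φ (x, s))
        = ∫ s in (0 : ℝ)..t, μ / (1 + s) * Z₀ s := by
      refine intervalIntegral.integral_congr fun s hs => ?_
      simp only [hφI s (hsub s hs), hZ₀]
      rw [← integral_const_mul]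
      simp only [mul_assoc]
    have e5 : (∫ s in (0 : ℝ)..t, ∫ x, |u s x| ^ p * φ (x, s)) = ∫ s in (0 : ℝ)..t, r₀ s := by
      refine intervalIntegral.integral_congr fun s hs => ?_
      simp only [hφI s (hsub s hs), hr₀]
    rw [e1, e2, e3, e4, e5, intervalIntegral.integral_neg] at he
    have i1 : IntervalIntegrable (fun s => l * Y₀ s) volume 0 t :=
      ((continuousOn_const.mul hYc).mono hsub).intervalIntegrable
    have i2 : IntervalIntegrable (fun s => μ / (1 + s) * Z₀ s) volume 0 t := by
      refine ContinuousOn.intervalIntegrable (((continuousOn_const.div (by fun_prop)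
        fun s hs => ?_).mul hZc).mono hsub)
      linarith [hs.1]
    rw [intervalIntegral.integral_sub (i1.add (hrint t ht)) i2,
      intervalIntegral.integral_add i1 (hrint t ht)]
    linarith
  -- Continuity of `u` in `L^p_loc` is what allows the integrated identity `hZint` to be
  -- differentiated at every interior time.
  have hrc : ∀ t ∈ Set.Ioo 0 t₁, ContinuousAt r₀ t := by
    intro t ht
    have hrK : r₀ = fun s => ∫ x in K, |u s x| ^ p * Φ x := by
      funext s
      rw [setIntegral_eq_integral_of_forall_compl_eq_zero]
      intro x hx
      rw [hΦK x hx, mul_zero]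
    rw [hrK]
    have htT := hI (Set.Ioo_subset_Icc_self ht)
    refine continuousAt_integral_rpow hp hΦs.continuous.measurable hΦ0 hc ?_
      (h.continuous_Lp_loc t htT ht.1 K hKc)
    filter_upwards [Ioo_mem_nhds ht.1 ht.2] with s hs
    exact h.memLp_loc s (hI (Set.Ioo_subset_Icc_self hs)) hs.1 K hKc
  have hZd : ∀ t ∈ Set.Ioo 0 t₁, HasDerivAt Z₀ (l * Y₀ t + r₀ t - μ / (1 + t) * Z₀ t) t := by
    intro t ht
    have hcont : ∀ s ∈ Set.Ioo 0 t₁,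
        ContinuousAt (fun s => l * Y₀ s + r₀ s - μ / (1 + s) * Z₀ s) s := by
      intro s hs
      have hn := Icc_mem_nhds hs.1 hs.2
      refine ((continuousAt_const.mul (hYc.continuousAt hn)).add (hrc s hs)).sub
        ((continuousAt_const.div (by fun_prop) ?_).mul (hZc.continuousAt hn))
      linarith [hs.1]
    have hint : IntervalIntegrable (fun s => l * Y₀ s + r₀ s - μ / (1 + s) * Z₀ s) volume 0 t := by
      have hsub : ∀ s ∈ Set.uIcc 0 t, s ∈ Set.Icc 0 t₁ := fun s hs => by
        rw [Set.uIcc_of_le ht.1.le] at hs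
        exact ⟨hs.1, hs.2.trans ht.2.le⟩
      refine (IntervalIntegrable.add ((continuousOn_const.mul hYc).mono hsub).intervalIntegrable
        (hrint t (Set.Ioo_subset_Icc_self ht))).sub (ContinuousOn.intervalIntegrable
        (((continuousOn_const.div (by fun_prop) fun s hs => ?_).mul hZc).mono hsub))
      linarith [hs.1]
    have hd := (intervalIntegral.integral_hasDerivAt_right hint
      (ContinuousOn.stronglyMeasurableAtFilter isOpen_Ioo
        (fun s hs => (hcont s hs).continuousWithinAt) t ht) (hcont t ht)).const_add (Z₀ 0)
    refine hd.congr_of_eventuallyEq ?_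
    filter_upwards [Ioo_mem_nhds ht.1 ht.2] with s hs
    exact hZint s (Set.Ioo_subset_Icc_self hs)
  have hshift : ∀ s ∈ Set.Icc 1 (1 + t₁), s - 1 ∈ Set.Icc 0 t₁ := fun s hs =>
    ⟨by linarith [hs.1], by linarith [hs.2]⟩
  have hshift' : ∀ s ∈ Set.Ioo 1 (1 + t₁), s - 1 ∈ Set.Ioo 0 t₁ := fun s hs =>
    ⟨by linarith [hs.1], by linarith [hs.2]⟩
  have hsubc : ContinuousOn (fun s : ℝ => s - 1) (Set.Icc 1 (1 + t₁)) := by fun_prop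
  refine ⟨fun s => Y₀ (s - 1), fun s => Z₀ (s - 1), fun s => r₀ (s - 1),
    ⟨hYc.comp hsubc hshift, hZc.comp hsubc hshift,
      fun s hs => (hYd _ (hshift' s hs)).comp_sub_const s 1, fun s hs => ?_,
      fun s _ => integral_nonneg fun x =>
        mul_nonneg (Real.rpow_nonneg (abs_nonneg _) _) (hΦ0 x)⟩, ?_, ?_, fun s hs => ?_,
        fun s hs => ?_⟩
  · have := (hZd _ (hshift' s hs)).comp_sub_const s 1
    rwa [show 1 + (s - 1) = s by ring] at this
  · have h0 := hball 0 ⟨le_rfl, ht₁.le⟩ id rfl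
    simp only [id, zero_add] at h0
    simp only [sub_self, hY₀]
    rw [h0, ← integral_const_mul]
    refine integral_congr_ae (ae_restrict_of_ae ?_)
    filter_upwards [h.initial_u] with x hx
    rw [hx]
    ring
  · simp only [sub_self, hY₀, hZ₀]
    rw [← integral_const_mul, ← integral_neg]
    refine integral_congr_ae ?_
    filter_upwards [h.initial_u, h.initial_v, hfg] with x hx hx' hx''
    rw [hx, hx']
    linear_combination ε * Φ x * hx''
  · exact hball (s - 1) (hshift s hs) id rfl
  · exact hball (s - 1) (hshift s (Set.Ioc_subset_Icc_self hs)) (fun y => |y| ^ p)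
      (by simp [(by linarith : p ≠ 0)])

/-- Hölder's inequality on a ball. -/
lemma integral_mul_rpow_le {n : ℕ} {p X : ℝ} (hp : 1 < p) {w ψ : Space n → ℝ}
    (hw : MemLp w (ENNReal.ofReal p) (volume.restrict (Metric.closedBall 0 X)))
    (hψ : Continuous ψ) (hψ0 : ∀ x, 0 ≤ ψ x)
    (hY : 0 ≤ ∫ x in Metric.closedBall 0 X, w x * ψ x) :
    (∫ x in Metric.closedBall 0 X, w x * ψ x) ^ p ≤
      (∫ x in Metric.closedBall 0 X, |w x| ^ p) *
        (∫ x in Metric.closedBall 0 X, ψ x ^ (p / (p - 1))) ^ (p - 1) := by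
  have hp0 : 0 < p := by linarith
  have hp1 : 0 < p - 1 := by linarith
  have hconj : p.HolderConjugate (p / (p - 1)) := Real.HolderConjugate.conjExponent hp
  have hψm : MemLp ψ (ENNReal.ofReal (p / (p - 1)))
      (volume.restrict (Metric.closedBall (0 : Space n) X)) := by
    obtain ⟨C, hC⟩ := (isCompact_closedBall (0 : Space n) X).exists_bound_of_continuousOn
      hψ.continuousOn
    have : IsFiniteMeasure (volume.restrict (Metric.closedBall (0 : Space n) X)) :=
      isFiniteMeasure_restrict.2 measure_closedBall_lt_top.ne
    exact MemLp.of_bound hψ.aestronglyMeasurable C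
      ((ae_restrict_iff' measurableSet_closedBall).2 (Eventually.of_forall hC))
  have h1 := integral_mul_le_Lp_mul_Lq_of_nonneg hconj
    (μ := volume.restrict (Metric.closedBall (0 : Space n) X)) (f := fun x => |w x|) (g := ψ)
    (Eventually.of_forall fun x => abs_nonneg _) (Eventually.of_forall hψ0) hw.abs hψm
  have h2 : ∫ x in Metric.closedBall 0 X, w x * ψ x ≤
      ∫ x in Metric.closedBall 0 X, |w x| * ψ x := by
    refine (le_abs_self _).trans ((abs_integral_le_integral_abs).trans (le_of_eq ?_))
    congr 1
    funext x
    rw [abs_mul, abs_of_nonneg (hψ0 x)]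
  have a0 : 0 ≤ ∫ x in Metric.closedBall 0 X, |w x| ^ p :=
    integral_nonneg fun x => Real.rpow_nonneg (abs_nonneg _) _
  have b0 : 0 ≤ ∫ x in Metric.closedBall 0 X, ψ x ^ (p / (p - 1)) :=
    integral_nonneg fun x => Real.rpow_nonneg (hψ0 x) _
  refine (Real.rpow_le_rpow hY (h2.trans h1) hp0.le).trans (le_of_eq ?_)
  rw [Real.mul_rpow (Real.rpow_nonneg a0 _) (Real.rpow_nonneg b0 _), ← Real.rpow_mul a0,
    ← Real.rpow_mul b0, one_div_mul_cancel hp0.ne', Real.rpow_one]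
  congr 2
  field_simp

/-! ### The mass of an energy solution and its differential inequalities -/

lemma laplace_const {n : ℕ} (c : ℝ) (x : Space n) : laplace (fun _ => c) x = 0 := by
  simp [laplace]

/-- Powers of either sign are comparable at comparable arguments; the exponent `|Q|` in the constant
covers both signs at once. -/
lemma rpow_mul_le_of_le_mul (Q : ℝ) {s X C : ℝ} (hs : 0 < s) (hsX : s ≤ X) (hX : X ≤ C * s) :
    X ^ Q ≤ C ^ |Q| * s ^ Q := by
  have hC : 1 ≤ C := by
    by_contra! h
    nlinarith
  have hX0 : 0 < X := hs.trans_le hsX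
  rcases le_total 0 Q with hQ | hQ
  · rw [abs_of_nonneg hQ, ← Real.mul_rpow (by linarith) hs.le]
    exact Real.rpow_le_rpow hX0.le hX hQ
  · have h1 : X ^ Q ≤ s ^ Q := Real.rpow_le_rpow_of_nonpos hs hsX hQ
    have h2 : 1 ≤ C ^ |Q| := Real.one_le_rpow hC (abs_nonneg Q)
    exact h1.trans (le_mul_of_one_le_left (Real.rpow_nonneg hs.le _) h2)

/-- The total mass of an energy solution, its equation, and the two lower bounds for the
nonlinear term. -/
theorem exists_mass_bounds {n : ℕ} (hn : 1 ≤ n) {μ p R m : ℝ} (hp : 1 < p)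
    (hR : 1 ≤ R) (hm : m * (m + 1 - μ) = 0) {f g : Space n → ℝ} (hf : MemLp f 2 volume)
    (hf_nonneg : ∀ᵐ x, 0 ≤ f x) (hf_ne : ¬ ∀ᵐ x, f x = 0)
    (hf_supp : ∀ᵐ x, R < ‖x‖ → f x = 0) (hfg : ∀ᵐ x, m * f x + g x = 0) :
    ∃ I c₀ c₁ : ℝ, 0 < I ∧ 0 < c₀ ∧ 0 < c₁ ∧ ∀ (ε : ℝ) (T : ℝ≥0∞)
      (u v : ℝ → Lp ℝ 2 (volume : Measure (Space n)))
      (G : ℝ → Lp (Space n) 2 (volume : Measure (Space n))),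
      0 < ε → IsEnergySolution μ p ε f g T u v G → SupportedInCone R T u →
      ∀ t₁, 0 < t₁ → t₁ ∈ timeInterval T → ∃ Y Z r : ℝ → ℝ,
        DampedODE μ 0 (1 + t₁) Y Z r ∧ Y 1 = ε * I ∧ Z 1 = -(m * (ε * I)) ∧
        (∀ s ∈ Set.Ioc 1 (1 + t₁), 0 ≤ Y s → c₀ * s ^ (-(n * (p - 1))) * Y s ^ p ≤ r s) ∧
        (∀ s ∈ Set.Ioc 1 (1 + t₁),
          c₁ * ε ^ p * s ^ ((n : ℝ) - 1 - (n + μ - 1) * p / 2) ≤ r s) := by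
  have hp0 : 0 < p := by linarith
  have hp1 : 0 < p - 1 := by linarith
  have hp' : 0 < p / (p - 1) := by positivity
  set B : Set (Space n) := Metric.closedBall 0 R with hB
  have hBc : IsCompact B := isCompact_closedBall _ _
  have hfB : IntegrableOn f B := (hf.locallyIntegrable (by norm_num)).integrableOn_isCompact hBc
  set I := ∫ x in B, f x with hI
  have hIpos : 0 < I := by
    have h0 : 0 ≤ I := integral_nonneg_of_ae (ae_restrict_of_ae hf_nonneg)
    refine lt_of_le_of_ne h0 fun h0 => hf_ne ?_
    have h1 := (integral_eq_zero_iff_of_nonneg_ae (ae_restrict_of_ae hf_nonneg) hfB).1 h0.symm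
    have h2 := (ae_restrict_iff' measurableSet_closedBall).1 h1
    filter_upwards [h2, hf_supp] with x hx hx'
    by_cases hxR : R < ‖x‖
    · exact hx' hxR
    · exact hx (by simpa using hxR)
  set A := ∫ x in B, f x * radialEigen x with hA
  have hApos : 0 < A := by
    refine hIpos.trans_le (integral_mono_ae hfB
      (hfB.mul_continuousOn (contDiff_radialEigen hn).continuous.continuousOn hBc) ?_)
    refine ae_restrict_of_ae ?_
    filter_upwards [hf_nonneg] with x hx
    exact le_mul_of_one_le_right hx (one_le_radialEigen hn x)
  obtain ⟨C, hC, hCint⟩ := exists_integral_radialEigen_le hn hp'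
  obtain ⟨c, hc, hclow⟩ := exists_weighted_lower hm
  set Q : ℝ := ((n : ℝ) - 1) * (1 - p / (p - 1) / 2) with hQ
  set V : ℝ := (volume : Measure (Space n)).real (Metric.ball 0 1) with hV
  have hVpos : 0 < V := by
    rw [hV, Measure.real, ENNReal.toReal_pos_iff]
    exact ⟨Metric.measure_ball_pos _ _ one_pos, measure_ball_lt_top⟩
  have hR0 : 0 < R := by linarith
  set D₀ : ℝ := (V * R ^ n) ^ (p - 1) with hD₀
  have hD₀pos : 0 < D₀ := Real.rpow_pos_of_pos (by positivity) _
  set D₁ : ℝ := (C * ((1 + R) ^ |Q| * Real.exp (p / (p - 1) * (R - 1)))) ^ (p - 1) with hD₁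
  have hD₁pos : 0 < D₁ := Real.rpow_pos_of_pos (by
    have := Real.rpow_pos_of_pos (by linarith : 0 < 1 + R) |Q|
    positivity) _
  have hcA : 0 < (c * A) ^ p := Real.rpow_pos_of_pos (by positivity) _
  refine ⟨I, 1 / D₀, (c * A) ^ p / D₁, hIpos, by positivity, by positivity, ?_⟩
  intro ε T u v G hε h hcone t₁ ht₁ hT
  obtain ⟨Y, Z, r, hODE, hY1, hZ1, hYeq, hreq⟩ := h.dampedODE hp hR hcone ht₁ hT
    (ψ := fun _ => 1) contDiff_const (fun _ => zero_le_one) (l := 0)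
    (fun x => by rw [laplace_const, zero_mul]) hfg
  obtain ⟨Y', Z', r', hODE', hY1', hZ1', hYeq', hreq'⟩ := h.dampedODE hp hR hcone ht₁ hT
    (contDiff_radialEigen hn) (fun x => zero_le_one.trans (one_le_radialEigen hn x)) (l := 1)
    (fun x => by rw [laplace_radialEigen hn, one_mul]) hfg
  simp only [mul_one] at hY1 hYeq hreq
  have hmem : ∀ s ∈ Set.Ioc 1 (1 + t₁), MemLp (u (s - 1)) (ENNReal.ofReal p)
      (volume.restrict (Metric.closedBall 0 (s - 1 + R))) := fun s hs =>
    h.memLp_loc _ (Icc_subset_timeInterval hT ⟨by linarith [hs.1], by linarith [hs.2]⟩)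
      (by linarith [hs.1]) _ (isCompact_closedBall _ _)
  refine ⟨Y, Z, r, hODE, hY1, by rw [hZ1, hY1], fun s hs hYs => ?_, fun s hs => ?_⟩
  · have hs0 : 0 < s := one_pos.trans hs.1
    have hX0 : 0 < s - 1 + R := by linarith [hs.1]
    have h1 := integral_mul_rpow_le hp (hmem s hs) (ψ := fun _ => 1) continuous_const
      (fun _ => zero_le_one) (by simpa only [mul_one, ← hYeq s (Set.Ioc_subset_Icc_self hs)])
    simp only [mul_one, Real.one_rpow, ← hYeq s (Set.Ioc_subset_Icc_self hs), ← hreq s hs] at h1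
    have hr0 : 0 ≤ r s := by
      rw [hreq s hs]; exact integral_nonneg fun x => Real.rpow_nonneg (abs_nonneg _) _
    have h2 : ∫ _ in Metric.closedBall (0 : Space n) (s - 1 + R), (1 : ℝ) ≤ V * R ^ n * s ^ n := by
      rw [setIntegral_const, smul_eq_mul, mul_one, Measure.real,
        Measure.addHaar_closedBall _ _ hX0.le, ENNReal.toReal_mul, finrank_euclideanSpace_fin,
        ENNReal.toReal_ofReal (by positivity), mul_comm, mul_assoc, ← mul_pow]
      refine mul_le_mul_of_nonneg_left (pow_le_pow_left₀ hX0.le ?_ n) hVpos.le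
      nlinarith [hs.1]
    have h3 : Y s ^ p ≤ r s * (D₀ * s ^ ((n : ℝ) * (p - 1))) := by
      refine h1.trans (mul_le_mul_of_nonneg_left ?_ hr0)
      refine (Real.rpow_le_rpow (integral_nonneg fun _ => zero_le_one) h2 hp1.le).trans
        (le_of_eq ?_)
      rw [Real.mul_rpow (by positivity) (by positivity), ← Real.rpow_natCast s n,
        ← Real.rpow_mul hs0.le]
    have hsn := Real.rpow_pos_of_pos hs0 ((n : ℝ) * (p - 1))
    rw [Real.rpow_neg hs0.le, one_div, ← mul_inv, inv_mul_le_iff₀ (by positivity)]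
    linarith
  · have hs0 : 0 < s := one_pos.trans hs.1
    have hX0 : 0 ≤ s - 1 + R := by linarith [hs.1]
    have hεA : 0 < ε * A := by positivity
    have hlow := hclow _ _ _ _ hODE' (by rw [hY1']; exact hεA) hZ1' s (Set.Ioc_subset_Icc_self hs)
    rw [hY1'] at hlow
    have hsμ := Real.rpow_pos_of_pos hs0 (-(μ / 2))
    have hL0 : 0 < c * (ε * A) * (s ^ (-(μ / 2)) * Real.exp s) := by positivity
    have hYpos := hL0.trans_le hlow
    have hYi := hYeq' s (Set.Ioc_subset_Icc_self hs)
    have h1 := integral_mul_rpow_le hp (hmem s hs) (contDiff_radialEigen hn).continuous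
      (fun x => zero_le_one.trans (one_le_radialEigen hn x)) (by rw [← hYi]; exact hYpos.le)
    rw [← hYi, ← hreq s hs] at h1
    have hr0 : 0 ≤ r s := by
      rw [hreq s hs]; exact integral_nonneg fun x => Real.rpow_nonneg (abs_nonneg _) _
    have h2 : ∫ x in Metric.closedBall (0 : Space n) (s - 1 + R), radialEigen x ^ (p / (p - 1)) ≤
        C * ((1 + R) ^ |Q| * Real.exp (p / (p - 1) * (R - 1))) *
          (s ^ Q * Real.exp (p / (p - 1) * s)) := by
      refine (hCint _ hX0).trans ?_
      have e1 := rpow_mul_le_of_le_mul Q (C := 1 + R) (X := 1 + (s - 1 + R)) hs0 (by linarith)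
        (by nlinarith [hs.1])
      rw [show p / (p - 1) * (s - 1 + R) = p / (p - 1) * (R - 1) + p / (p - 1) * s by ring,
        Real.exp_add]
      calc _ ≤ C * ((1 + R) ^ |Q| * s ^ Q *
            (Real.exp (p / (p - 1) * (R - 1)) * Real.exp (p / (p - 1) * s))) := by gcongr
        _ = _ := by ring
    have hsQ := Real.rpow_pos_of_pos hs0 Q
    have hRQ := Real.rpow_pos_of_pos (by linarith : 0 < 1 + R) |Q|
    have h3 : Y' s ^ p ≤ r s * (D₁ * (s ^ (Q * (p - 1)) * Real.exp (p * s))) := by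
      refine h1.trans (mul_le_mul_of_nonneg_left ?_ hr0)
      refine (Real.rpow_le_rpow (integral_nonneg fun x => Real.rpow_nonneg
        (zero_le_one.trans (one_le_radialEigen hn x)) _) h2 hp1.le).trans (le_of_eq ?_)
      rw [Real.mul_rpow (by positivity) (by positivity), Real.mul_rpow hsQ.le (Real.exp_pos _).le,
        ← Real.rpow_mul hs0.le, ← Real.exp_mul, ← hD₁]
      congr 3
      field_simp
    have h4 := (Real.rpow_le_rpow hL0.le hlow hp0.le).trans h3
    rw [show c * (ε * A) = c * A * ε by ring, Real.mul_rpow (by positivity) (by positivity),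
      Real.mul_rpow (by positivity) hε.le, Real.mul_rpow hsμ.le (Real.exp_pos _).le,
      ← Real.rpow_mul hs0.le, ← Real.exp_mul, mul_comm s p] at h4
    -- The exponential `e^(ps)` occurs on both sides of Hölder's inequality and cancels; only the
    -- powers of `s` remain, with `Q (p-1) = (n-1)(p/2 - 1)`.
    have hexp : (n : ℝ) - 1 - (n + μ - 1) * p / 2 = -(μ / 2) * p + -(Q * (p - 1)) := by
      rw [hQ]; field_simp; ring
    rw [hexp, Real.rpow_add hs0, Real.rpow_neg hs0.le (Q * (p - 1))]
    have hsQp := Real.rpow_pos_of_pos hs0 (Q * (p - 1))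
    have he := Real.exp_pos (p * s)
    have h5 : (c * A) ^ p * ε ^ p * s ^ (-(μ / 2) * p) ≤ r s * (D₁ * s ^ (Q * (p - 1))) := by
      refine le_of_mul_le_mul_right ?_ he
      linarith
    calc (c * A) ^ p / D₁ * ε ^ p * (s ^ (-(μ / 2) * p) * (s ^ (Q * (p - 1)))⁻¹)
        = ((c * A) ^ p * ε ^ p * s ^ (-(μ / 2) * p)) / (D₁ * s ^ (Q * (p - 1))) := by
          field_simp
      _ ≤ r s := by rw [div_le_iff₀ (by positivity)]; exact h5

/-- The properties of the total mass of an energy solution that force blow-up. -/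
structure MassODE (n : ℕ) (μ p m I c₀ c₁ ε b : ℝ) (Y Z r : ℝ → ℝ) : Prop where
  ode : DampedODE μ 0 b Y Z r
  init : Y 1 = ε * I
  init_deriv : Z 1 = -(m * (ε * I))
  le_of_mass : ∀ s ∈ Set.Ioc 1 b, 0 ≤ Y s → c₀ * s ^ (-(n * (p - 1))) * Y s ^ p ≤ r s
  le_of_data : ∀ s ∈ Set.Ioc 1 b, c₁ * ε ^ p * s ^ ((n : ℝ) - 1 - (n + μ - 1) * p / 2) ≤ r s

/-- If `f` is not supported in the ball of radius `R`, the cone condition at time `0` excludes every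
energy solution; the lifespan is then a supremum over the empty set and any constants will do. -/
lemma exists_massODE {n : ℕ} (hn : 1 ≤ n) {μ p R m : ℝ} (hp : 1 < p)
    (hR : 1 ≤ R) (hm : m * (m + 1 - μ) = 0) {f g : Space n → ℝ} (hf : MemLp f 2 volume)
    (hf_nonneg : ∀ᵐ x, 0 ≤ f x) (hf_ne : ¬ ∀ᵐ x, f x = 0) (hfg : ∀ᵐ x, m * f x + g x = 0) :
    ∃ I c₀ c₁ : ℝ, 0 < I ∧ 0 < c₀ ∧ 0 < c₁ ∧ ∀ ε B : ℝ, 0 < ε → 0 < B →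
      ENNReal.ofReal B < lifespan μ p R f g ε →
      ∃ Y Z r : ℝ → ℝ, MassODE n μ p m I c₀ c₁ ε (1 + B) Y Z r := by
  by_cases hf_supp : ∀ᵐ x, R < ‖x‖ → f x = 0
  · obtain ⟨I, c₀, c₁, hI, hc₀, hc₁, H⟩ :=
      exists_mass_bounds hn hp hR hm hf hf_nonneg hf_ne hf_supp hfg
    refine ⟨I, c₀, c₁, hI, hc₀, hc₁, fun ε B hε hB hlt => ?_⟩
    obtain ⟨T, ⟨u, v, G, hsol, hcone⟩, hT⟩ := lt_sSup_iff.1 hlt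
    obtain ⟨Y, Z, r, h1, h2, h3, h4, h5⟩ := H ε T u v G hε hsol hcone B hB ⟨hB.le, hT⟩
    exact ⟨Y, Z, r, h1, h2, h3, h4, h5⟩
  · refine ⟨1, 1, 1, one_pos, one_pos, one_pos, fun ε B hε hB hlt => ?_⟩
    obtain ⟨T, ⟨u, v, G, hsol, hcone⟩, hT⟩ := lt_sSup_iff.1 hlt
    refine absurd ?_ hf_supp
    filter_upwards [hcone 0 ⟨le_rfl, by simpa using hsol.T_pos⟩, hsol.initial_u] with x hx hx' hxR
    rw [hx (by simpa using hxR)] at hx'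
    exact (mul_eq_zero.1 hx'.symm).resolve_left hε.ne'

/-! ### Lower bounds for the mass and upper bounds for the lifespan -/

section

variable {n : ℕ} {μ p m I c₀ c₁ : ℝ}

/-- On `[S, 2S]` the decaying coefficient `c₀ s^(-n(p-1))` is at least its value at `2S`, which
serves as the constant `β` of the window estimate. -/
lemma MassODE.exists_blowup_bound (n : ℕ) (I c₁ : ℝ) (hμ : 0 ≤ μ) (hp : 1 < p)
    (hm : m * (m + 1 - μ) = 0) (hI : 0 ≤ I) (hc₀ : 0 < c₀) : ∃ K : ℝ, 0 < K ∧
    ∀ (ε S A : ℝ) (Y Z r : ℝ → ℝ), 0 < ε → 1 ≤ S → 0 < A →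
      MassODE n μ p m I c₀ c₁ ε (2 * S) Y Z r → (∀ s ∈ Set.Icc S (2 * S), A ≤ Y s) →
      A ^ (p - 1) * S ^ (2 - n * (p - 1)) ≤ K := by
  obtain ⟨K, hK, H⟩ := DampedWave.exists_blowup_bound hμ hp
  have h2 : 0 < (2 : ℝ) ^ (-(n * (p - 1))) := Real.rpow_pos_of_pos two_pos _
  refine ⟨K / (c₀ * 2 ^ (-(n * (p - 1)))), by positivity, fun ε S A Y Z r hε hS hA h hAY => ?_⟩
  have hS0 : 0 < S := by linarith
  have hβ : 0 < c₀ * (2 * S) ^ (-(n * (p - 1))) :=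
    mul_pos hc₀ (Real.rpow_pos_of_pos (by positivity) _)
  have := H m (ε * I) S (c₀ * (2 * S) ^ (-(n * (p - 1)))) A Y Z r hm h.ode h.init (by positivity)
    h.init_deriv hS hA hβ hAY (fun s hs => by
      have hs0 : 0 < s := hS0.trans hs.1
      have hY0 : 0 ≤ Y s := hA.le.trans (hAY s (Set.Ioo_subset_Icc_self hs))
      refine le_trans ?_ (h.le_of_mass s ⟨hS.trans_lt hs.1, hs.2.le⟩ hY0)
      refine mul_le_mul_of_nonneg_right (mul_le_mul_of_nonneg_left ?_ hc₀.le)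
        (Real.rpow_nonneg hY0 _)
      refine Real.rpow_le_rpow_of_nonpos hs0 hs.2.le ?_
      have : 0 ≤ (n : ℝ) * (p - 1) := mul_nonneg (Nat.cast_nonneg n) (by linarith)
      linarith)
  rw [Real.mul_rpow two_pos.le hS0.le] at this
  rw [le_div_iff₀ (by positivity), show (2 : ℝ) - n * (p - 1) = -(n * (p - 1)) + (2 : ℕ) by
    push_cast; ring, Real.rpow_add hS0, Real.rpow_natCast]
  linarith

lemma MassODE.linear_lower {ε b : ℝ} {Y Z r : ℝ → ℝ} (hμ : 0 ≤ μ)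
    (hm : m * (m + 1 - μ) = 0) (h : MassODE n μ p m I c₀ c₁ ε b Y Z r) :
    ∀ s ∈ Set.Icc 1 b, ε * I * s ^ (-m) ≤ Y s :=
  (h.ode.step hμ hm h.init h.init_deriv).1

/-- The source is of size `ε^p s^a` throughout `[s/2, s]`, and two integrations raise the exponent
to `a + 2`. The restriction `s ≥ 2` keeps this interval inside `[1, b]`. -/
lemma MassODE.exists_power_lower (n : ℕ) (p I c₀ : ℝ) (hμ : 0 ≤ μ) (hm : m * (m + 1 - μ) = 0)
    (hc₁ : 0 < c₁) : ∃ c : ℝ, 0 < c ∧ ∀ (ε b : ℝ) (Y Z r : ℝ → ℝ), 0 < ε →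
      MassODE n μ p m I c₀ c₁ ε b Y Z r → ∀ s ∈ Set.Icc 2 b,
        ε * I * s ^ (-m) + c * ε ^ p * s ^ ((n : ℝ) + 1 - (n + μ - 1) * p / 2) ≤ Y s := by
  obtain ⟨a, ha⟩ : ∃ a, a = (n : ℝ) - 1 - (n + μ - 1) * p / 2 := ⟨_, rfl⟩
  have h2a : 0 < (2 : ℝ) ^ |a| := Real.rpow_pos_of_pos two_pos _
  have h2μ : 0 < (1 / 2 : ℝ) ^ μ := Real.rpow_pos_of_pos (by norm_num) _
  refine ⟨(1 / 2) ^ μ * c₁ / 2 ^ |a| / 8, by positivity, fun ε b Y Z r hε h s hs => ?_⟩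
  have hs0 : 0 < s := by linarith [hs.1]
  have hsa := Real.rpow_pos_of_pos hs0 a
  have hεp := Real.rpow_pos_of_pos hε p
  have := (h.ode.step hμ hm h.init h.init_deriv).2 (c₁ * ε ^ p * (s ^ a / 2 ^ |a|)) (s / 2) s
    (by positivity) (by linarith [hs.1]) (by linarith) hs.2 (fun x hx => by
      have hx0 : 0 < x := by linarith [hx.1]
      refine le_trans ?_ (h.le_of_data x ⟨by linarith [hx.1, hs.1], hx.2.le.trans hs.2⟩)
      rw [← ha]
      refine mul_le_mul_of_nonneg_left ?_ (by positivity)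
      rw [div_le_iff₀ h2a, mul_comm]
      exact rpow_mul_le_of_le_mul a hx0 hx.2.le (by linarith [hx.1])) s ⟨by linarith, le_rfl⟩
  refine le_trans (le_of_eq ?_) this
  rw [show (n : ℝ) + 1 - (n + μ - 1) * p / 2 = a + (2 : ℕ) by rw [ha]; push_cast; ring,
    Real.rpow_add hs0, Real.rpow_natCast, show s / 2 / s = 1 / 2 by field_simp]
  ring

/-- What the nonlinear term has contributed by `s = 2` is never lost, because the excess `Y - εI
s^(-m)` is nondecreasing. -/
lemma MassODE.exists_const_lower (n : ℕ) (p I c₀ : ℝ) (hμ : 0 ≤ μ) (hm : m * (m + 1 - μ) = 0)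
    (hI : 0 < I) (hc₁ : 0 < c₁) : ∃ c : ℝ, 0 < c ∧ ∀ (ε b : ℝ) (Y Z r : ℝ → ℝ), 0 < ε →
      MassODE n μ p m I c₀ c₁ ε b Y Z r → ∀ s ∈ Set.Icc 2 b, c * ε ^ p ≤ Y s := by
  obtain ⟨c, hc, H⟩ := MassODE.exists_power_lower n p I c₀ hμ hm hc₁
  have h2 : 0 < (2 : ℝ) ^ ((n : ℝ) + 1 - (n + μ - 1) * p / 2) := Real.rpow_pos_of_pos two_pos _
  refine ⟨c * 2 ^ ((n : ℝ) + 1 - (n + μ - 1) * p / 2), by positivity,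
    fun ε b Y Z r hε h s hs => ?_⟩
  have h1 := H ε b Y Z r hε h 2 ⟨le_rfl, hs.1.trans hs.2⟩
  have hE := h.ode.sub_linear hm (ε * I)
  have h2m : (2 : ℝ) ∈ Set.Icc 1 b := ⟨by norm_num, hs.1.trans hs.2⟩
  have hsm : s ∈ Set.Icc 1 b := ⟨by linarith [hs.1], hs.2⟩
  have hmono := hE.monotoneOn (by simp [h.init_deriv]) (by simp) h2m hsm hs.1
  simp only at hmono
  have hs0 : 0 < s := by linarith [hs.1]
  have : 0 ≤ ε * I * s ^ (-m) := mul_nonneg (by positivity) (Real.rpow_nonneg hs0.le _)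
  linarith

/-- In the critical case the mass grows logarithmically. -/
lemma MassODE.log_lower {ε b : ℝ} {Y Z r : ℝ → ℝ} (hm0 : 0 < m) (hm : m + 1 = μ) (hI : 0 < I)
    (hε : 0 < ε) (hp : (n : ℝ) - 1 - (n + μ - 1) * p / 2 = -2)
    (h : MassODE n μ p m I c₀ c₁ ε b Y Z r) :
    ∀ s ∈ Set.Icc 1 b, c₁ * ε ^ p / m * (Real.log s + (s ^ (-m) - 1) / m) ≤ Y s := by
  obtain ⟨k, hk⟩ : ∃ k, k = c₁ * ε ^ p / m := ⟨_, rfl⟩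
  have hE := h.ode.sub_linear (m := m) (by rw [hm]; ring) (ε * I)
  have hpos : ∀ s ∈ Set.Icc 1 b, 0 < s := fun s hs => by linarith [hs.1]
  have hlog : ContinuousOn Real.log (Set.Icc 1 b) :=
    Real.continuousOn_log.mono fun s hs => (hpos s hs).ne'
  have hpow : ∀ e : ℝ, ContinuousOn (fun s : ℝ => s ^ e) (Set.Icc 1 b) := fun e =>
    continuousOn_id.rpow_const fun s hs => Or.inl (hpos s hs).ne'
  -- The subtracted function solves the equation with source `k m s^(-2) = c₁ ε^p s^(-2)` and has
  -- zero value and derivative at `1`. The source bound `le_of_data` then leaves a nonnegative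
  -- remainder.
  have hode : DampedODE μ 0 b
      (fun s => (Y s - ε * I * s ^ (-m)) - k * (Real.log s + (s ^ (-m) - 1) / m))
      (fun s => (Z s + m * (ε * I) * s ^ (-m - 1)) - k * (s⁻¹ - s ^ (-m - 1)))
      (fun s => r s - k * m * s ^ (-2 : ℝ)) := by
    refine ⟨hE.cont.sub (continuousOn_const.mul
      (hlog.add (((hpow _).sub continuousOn_const).div_const m))),
      hE.cont_deriv.sub (continuousOn_const.mul ((continuousOn_inv₀.mono
        fun s hs => (hpos s hs).ne').sub (hpow _))), fun s hs => ?_, fun s hs => ?_, fun s hs => ?_⟩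
    · have hs0 := hpos s (Set.Ioo_subset_Icc_self hs)
      refine ((hE.hasDerivAt s hs).fun_sub (((Real.hasDerivAt_log hs0.ne').fun_add
        (((Real.hasDerivAt_rpow_const (p := -m) (Or.inl hs0.ne')).sub_const 1).div_const
          m)).const_mul k)).congr_deriv ?_
      field_simp
      ring
    · have hs0 := hpos s (Set.Ioo_subset_Icc_self hs)
      refine ((hE.hasDerivAt_deriv s hs).fun_sub (((hasDerivAt_inv hs0.ne').fun_sub
        (Real.hasDerivAt_rpow_const (p := -m - 1) (Or.inl hs0.ne'))).const_mul k)).congr_deriv ?_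
      rw [Real.rpow_sub_one hs0.ne' (-m - 1), Real.rpow_neg hs0.le 2, Real.rpow_two, ← hm]
      field_simp
      ring
    · have := h.le_of_data s ⟨hs.1, hs.2.le⟩
      rw [hp] at this
      rw [hk, div_mul_cancel₀ _ hm0.ne']
      exact sub_nonneg.2 this
  intro s hs
  have h1 := hode.monotoneOn (by simp [h.init_deriv]) (by simp)
    (Set.left_mem_Icc.2 (hs.1.trans hs.2)) hs hs.1
  simp only [h.init, Real.one_rpow, Real.log_one, sub_self, zero_div, mul_one, add_zero,
    mul_zero] at h1
  have : 0 ≤ ε * I * s ^ (-m) := mul_nonneg (by positivity) (Real.rpow_nonneg (hpos s hs).le _)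
  rw [← hk]
  linarith

end

/-- From a lower bound of power type for the mass to an upper bound for the lifespan. -/
lemma exists_lifespan_le {n : ℕ} {μ p R m I c₀ c₁ : ℝ} {f g : Space n → ℝ} (hμ : 0 ≤ μ)
    (hp : 1 < p) (hm : m * (m + 1 - μ) = 0) (hI : 0 < I) (hc₀ : 0 < c₀)
    (H : ∀ ε B : ℝ, 0 < ε → 0 < B → ENNReal.ofReal B < lifespan μ p R f g ε →
      ∃ Y Z r : ℝ → ℝ, MassODE n μ p m I c₀ c₁ ε (1 + B) Y Z r)
    {c d α γ : ℝ} (hc : 0 < c) (hd : 0 < d) (hγ : γ = α * (p - 1) + 2 - n * (p - 1))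
    (hγ0 : 0 < γ)
    (hlow : ∀ (ε b : ℝ) (Y Z r : ℝ → ℝ), 0 < ε → MassODE n μ p m I c₀ c₁ ε b Y Z r →
      ∀ s ∈ Set.Icc 2 b, c * ε ^ d * s ^ α ≤ Y s) :
    ∃ C : ℝ, 0 < C ∧ ∀ ε : ℝ, 0 < ε → ε ≤ 1 →
      lifespan μ p R f g ε ≤ ENNReal.ofReal (C * ε ^ (-(d * (p - 1) / γ))) := by
  obtain ⟨K, hK, HK⟩ := MassODE.exists_blowup_bound (m := m) n I c₁ hμ hp hm hI.le hc₀
  have hp1 : 0 < p - 1 := by linarith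
  set k : ℝ := c / 2 ^ |α| with hk
  have h2α : 0 < (2 : ℝ) ^ |α| := Real.rpow_pos_of_pos two_pos _
  have hk0 : 0 < k := by positivity
  have hkp : 0 < k ^ (p - 1) := Real.rpow_pos_of_pos hk0 _
  set K' : ℝ := K / k ^ (p - 1) with hK'
  have hK'0 : 0 < K' := by positivity
  -- The `3` makes `S ≥ 2` when `1 + B = 2S`, as the lower bound requires; the other entry makes
  -- `(C/2)^γ` exceed the constant `K'` of the blow-up bound.
  set C : ℝ := max 3 (2 * (K' + 1) ^ (1 / γ)) with hC
  have hC3 : 3 ≤ C := le_max_left _ _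
  have hCγ : K' + 1 ≤ (C / 2) ^ γ := by
    have h1 : (K' + 1) ^ (1 / γ) ≤ C / 2 := by linarith [le_max_right 3 (2 * (K' + 1) ^ (1 / γ))]
    have h2 := Real.rpow_le_rpow (Real.rpow_nonneg (by linarith) _) h1 hγ0.le
    rwa [← Real.rpow_mul (by linarith), one_div_mul_cancel hγ0.ne', Real.rpow_one] at h2
  refine ⟨C, by linarith, fun ε hε hε1 => ?_⟩
  by_contra! hlt
  set e : ℝ := d * (p - 1) / γ with he
  have he0 : 0 < e := by positivity
  have hεe : 1 ≤ ε ^ (-e) := Real.one_le_rpow_of_pos_of_le_one_of_nonpos hε hε1 (by linarith)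
  set B : ℝ := C * ε ^ (-e) with hB
  have hB3 : 3 ≤ B := by nlinarith
  obtain ⟨Y, Z, r, h⟩ := H ε B hε (by linarith) hlt
  obtain ⟨S, hS⟩ : ∃ S, 1 + B = 2 * S := ⟨(1 + B) / 2, by ring⟩
  rw [hS] at h
  have hS2 : 2 ≤ S := by linarith
  have hS0 : 0 < S := by linarith
  have hSα := Real.rpow_pos_of_pos hS0 α
  have hεd := Real.rpow_pos_of_pos hε d
  have hb := HK ε S (k * ε ^ d * S ^ α) Y Z r hε (by linarith) (by positivity) h (fun s hs => by
    refine le_trans ?_ (hlow ε _ Y Z r hε h s ⟨hS2.trans hs.1, hs.2⟩)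
    have hs0 : 0 < s := hS0.trans_le hs.1
    have h1 := rpow_mul_le_of_le_mul (-α) hS0 hs.1 hs.2
    rw [abs_neg, Real.rpow_neg hS0.le, Real.rpow_neg hs0.le] at h1
    have hsα := Real.rpow_pos_of_pos hs0 α
    have h2 : S ^ α ≤ 2 ^ |α| * s ^ α := by
      rw [← div_eq_mul_inv, le_div_iff₀ hSα, inv_mul_le_iff₀ hsα] at h1
      linarith
    calc k * ε ^ d * S ^ α ≤ k * ε ^ d * (2 ^ |α| * s ^ α) := by gcongr
      _ = c * ε ^ d * s ^ α := by rw [hk]; field_simp)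
  rw [Real.mul_rpow (by positivity) hSα.le, Real.mul_rpow hk0.le hεd.le, ← Real.rpow_mul hε.le,
    ← Real.rpow_mul hS0.le, mul_assoc, ← Real.rpow_add hS0,
    show α * (p - 1) + (2 - n * (p - 1)) = γ by rw [hγ]; ring] at hb
  have hSB : C / 2 * ε ^ (-e) ≤ S := by linarith
  have h3 := Real.rpow_le_rpow (by positivity) hSB hγ0.le
  rw [Real.mul_rpow (by linarith) (by positivity), ← Real.rpow_mul hε.le,
    show -e * γ = -(d * (p - 1)) by rw [he]; field_simp, Real.rpow_neg hε.le] at h3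
  have hεdp := Real.rpow_pos_of_pos hε (d * (p - 1))
  have h4 : (C / 2) ^ γ ≤ ε ^ (d * (p - 1)) * S ^ γ := by
    rw [← div_eq_mul_inv, div_le_iff₀ hεdp] at h3
    linarith
  have h5 : ε ^ (d * (p - 1)) * S ^ γ ≤ K' := by
    rw [hK', le_div_iff₀ hkp]
    linarith
  linarith

/-- Existence and uniqueness of `σ₀(ε)`, which is at least `1` for `ε ≤ 1`. -/
lemma exists_isSigmaZero {n : ℕ} {p ε : ℝ} (hp : 1 < p) (hθ : 0 < 2 / (p - 1) - n) (hε : 0 < ε)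
    (hε1 : ε ≤ 1) : ∃ σ₀ : ℝ, IsSigmaZero n p ε σ₀ ∧ (∀ s, IsSigmaZero n p ε s → s = σ₀) ∧
      1 ≤ σ₀ := by
  obtain ⟨θ, hθd⟩ : ∃ θ, θ = 2 / (p - 1) - n := ⟨_, rfl⟩
  rw [← hθd] at hθ
  have hεp := Real.rpow_pos_of_pos hε p
  have hεp1 : ε ^ p ≤ 1 := Real.rpow_le_one hε.le hε1 (by linarith)
  have hmono : ∀ x y : ℝ, 0 < x → x < y →
      ε ^ p * x ^ θ * Real.log (1 + x) < ε ^ p * y ^ θ * Real.log (1 + y) := by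
    intro x y hx hxy
    have h1 := Real.rpow_lt_rpow hx.le hxy hθ
    have h2 := Real.log_lt_log (by linarith : 0 < 1 + x) (by linarith : 1 + x < 1 + y)
    have h3 := Real.log_pos (by linarith : 1 < 1 + x)
    have h4 := Real.rpow_pos_of_pos hx θ
    gcongr
  -- Chosen so that `log (1 + M) ≥ ε^(-p)`: the left side of the equation for `σ₀` is then at least
  -- `1` at `M`.
  obtain ⟨M, hM⟩ : ∃ M, M = Real.exp (ε ^ p)⁻¹ := ⟨_, rfl⟩
  have hM1 : 1 ≤ M := hM ▸ Real.one_le_exp (by positivity)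
  have hcont : ContinuousOn (fun x : ℝ => ε ^ p * x ^ θ * Real.log (1 + x)) (Set.Icc 0 M) := by
    refine ((continuousOn_const.mul (continuousOn_id.rpow_const fun x _ => Or.inr hθ.le))).mul
      (ContinuousOn.log (by fun_prop) fun x hx => ?_)
    linarith [hx.1]
  have hIVT := intermediate_value_Icc (by linarith : (0 : ℝ) ≤ M) hcont
  have hmem : (1 : ℝ) ∈ Set.Icc (ε ^ p * (0 : ℝ) ^ θ * Real.log (1 + 0))
      (ε ^ p * M ^ θ * Real.log (1 + M)) := by
    refine ⟨by simp, ?_⟩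
    have h1 : 1 ≤ M ^ θ := Real.one_le_rpow hM1 hθ.le
    have h2 : (ε ^ p)⁻¹ ≤ Real.log (1 + M) := by
      rw [Real.le_log_iff_exp_le (by linarith)]
      linarith
    calc (1 : ℝ) = ε ^ p * 1 * (ε ^ p)⁻¹ := by field_simp
      _ ≤ _ := by gcongr
  obtain ⟨σ, hσ, hσ1⟩ := hIVT hmem
  simp only at hσ1
  have hσ0 : 0 < σ := by
    rcases hσ.1.eq_or_lt with h | h
    · rw [← h] at hσ1
      simp at hσ1
    · exact h
  refine ⟨σ, ⟨hσ0, by rw [← hθd]; exact hσ1⟩, fun s hs => ?_, ?_⟩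
  · obtain ⟨hs0, hs1⟩ := hs
    rw [← hθd] at hs1
    rcases lt_trichotomy s σ with h | h | h
    · linarith [hmono s σ hs0 h]
    · exact h
    · linarith [hmono σ s hσ0 h]
  · by_contra! h
    have h1 := hmono σ 1 hσ0 h
    rw [hσ1, Real.one_rpow, mul_one, show (1 : ℝ) + 1 = 2 by norm_num] at h1
    have h2 := Real.log_two_lt_d9
    have h3 := Real.log_pos one_lt_two
    nlinarith

/-- The logarithmic case. -/
lemma exists_lifespan_le_log {n : ℕ} {μ p R m I c₀ c₁ : ℝ} {f g : Space n → ℝ} (hμ : 0 ≤ μ)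
    (hp : 1 < p) (hm0 : 0 < m) (hm : m + 1 = μ) (hI : 0 < I) (hc₀ : 0 < c₀) (hc₁ : 0 < c₁)
    (H : ∀ ε B : ℝ, 0 < ε → 0 < B → ENNReal.ofReal B < lifespan μ p R f g ε →
      ∃ Y Z r : ℝ → ℝ, MassODE n μ p m I c₀ c₁ ε (1 + B) Y Z r)
    (hpc : (n : ℝ) - 1 - (n + μ - 1) * p / 2 = -2) (hθ : 0 < 2 / (p - 1) - n) :
    ∃ C : ℝ, 0 < C ∧ ∀ ε : ℝ, 0 < ε → ε ≤ 1 → ∃ σ₀ : ℝ, IsSigmaZero n p ε σ₀ ∧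
      (∀ s : ℝ, IsSigmaZero n p ε s → s = σ₀) ∧
      lifespan μ p R f g ε ≤ ENNReal.ofReal (C * σ₀) := by
  obtain ⟨K, hK, HK⟩ := MassODE.exists_blowup_bound (m := m) n I c₁ hμ hp (by rw [hm]; ring) hI.le hc₀
  have hp1 : 0 < p - 1 := by linarith
  obtain ⟨θ, hθd⟩ : ∃ θ, θ = 2 / (p - 1) - n := ⟨_, rfl⟩
  rw [← hθd] at hθ
  set k : ℝ := c₁ / (2 * m) with hk
  have hk0 : 0 < k := by positivity
  set K' : ℝ := K ^ (1 / (p - 1)) / k with hK'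
  have hK'0 : 0 < K' := by have := Real.rpow_pos_of_pos hK (1 / (p - 1)); positivity
  -- For `1 + Cσ = 2S`, the `4` yields `1 + σ ≤ S`; the exponential yields `log S ≥ 2/m`, so the
  -- loss `1/m` in the logarithmic bound is at most half of `log S`; the last entry contradicts the
  -- blow-up bound.
  set C : ℝ := max (max 4 (2 * Real.exp (2 / m))) (2 * (K' + 1) ^ (1 / θ)) with hC
  have hC4 : 4 ≤ C := (le_max_left _ _).trans (le_max_left _ _)
  have hCe : 2 * Real.exp (2 / m) ≤ C := (le_max_right _ _).trans (le_max_left _ _)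
  have hCθ : K' + 1 ≤ (C / 2) ^ θ := by
    have h1 : (K' + 1) ^ (1 / θ) ≤ C / 2 := by
      have : 2 * (K' + 1) ^ (1 / θ) ≤ C := le_max_right _ _
      linarith
    have h2 := Real.rpow_le_rpow (Real.rpow_nonneg (by linarith) _) h1 hθ.le
    rwa [← Real.rpow_mul (by linarith), one_div_mul_cancel hθ.ne', Real.rpow_one] at h2
  refine ⟨C, by linarith, fun ε hε hε1 => ?_⟩
  obtain ⟨σ, hσ, huniq, hσ1⟩ := exists_isSigmaZero hp (hθd ▸ hθ) hε hε1
  refine ⟨σ, hσ, huniq, ?_⟩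
  by_contra! hlt
  obtain ⟨Y, Z, r, h⟩ := H ε (C * σ) hε (by positivity) hlt
  obtain ⟨S, hS⟩ : ∃ S, 1 + C * σ = 2 * S := ⟨(1 + C * σ) / 2, by ring⟩
  rw [hS] at h
  have hSσ : C / 2 * σ ≤ S := by linarith
  have hSC : C / 2 ≤ S := by nlinarith
  have hS1σ : 1 + σ ≤ S := by nlinarith
  have hS1 : 1 < S := by linarith
  have hS0 : 0 < S := by linarith
  have hεp := Real.rpow_pos_of_pos hε p
  have hlogS : 2 / m ≤ Real.log S := by
    rw [Real.le_log_iff_exp_le hS0]; linarith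
  have hlogS0 : 0 < Real.log S := Real.log_pos hS1
  have hb := HK ε S (k * ε ^ p * Real.log S) Y Z r hε hS1.le (by positivity) h (fun s hs => by
    refine le_trans ?_ (h.log_lower hm0 hm hI hε hpc s ⟨hS1.le.trans hs.1, hs.2⟩)
    have hs0 : 0 < s := hS0.trans_le hs.1
    have h1 : Real.log S ≤ Real.log s := Real.log_le_log hS0 hs.1
    have h2 : 0 ≤ s ^ (-m) / m := div_nonneg (Real.rpow_nonneg hs0.le _) hm0.le
    have h3 : 2 / m = 2 * (1 / m) := by ring
    have h4 : Real.log S / 2 ≤ Real.log s + (s ^ (-m) - 1) / m := by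
      rw [sub_div]
      linarith
    calc k * ε ^ p * Real.log S = c₁ * ε ^ p / m * (Real.log S / 2) := by
          rw [hk]; field_simp
      _ ≤ _ := by gcongr)
  have hSθ := Real.rpow_pos_of_pos hS0 θ
  have h1 : k * ε ^ p * Real.log S * S ^ θ ≤ K ^ (1 / (p - 1)) := by
    have h2 : (k * ε ^ p * Real.log S * S ^ θ) ^ (p - 1) ≤ K := by
      rw [Real.mul_rpow (by positivity) hSθ.le, ← Real.rpow_mul hS0.le,
        show θ * (p - 1) = 2 - n * (p - 1) by rw [hθd]; field_simp]
      exact hb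
    have h3 := Real.rpow_le_rpow (Real.rpow_nonneg (by positivity) _) h2
      (by positivity : 0 ≤ 1 / (p - 1))
    rwa [← Real.rpow_mul (by positivity), mul_one_div_cancel hp1.ne', Real.rpow_one] at h3
  have h2 : ε ^ p * Real.log S * S ^ θ ≤ K' := by
    rw [hK', le_div_iff₀ hk0]; linarith
  obtain ⟨hσ0, hσe⟩ := hσ
  rw [← hθd] at hσe
  have h3 : Real.log (1 + σ) ≤ Real.log S := Real.log_le_log (by linarith) hS1σ
  have h4 : (C / 2) ^ θ * σ ^ θ ≤ S ^ θ := by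
    rw [← Real.mul_rpow (by linarith) hσ0.le]
    exact Real.rpow_le_rpow (by positivity) hSσ hθ.le
  have hσθ := Real.rpow_pos_of_pos hσ0 θ
  have hCθ0 : 0 < (C / 2) ^ θ := Real.rpow_pos_of_pos (by linarith) _
  have hlσ : 0 ≤ Real.log (1 + σ) := Real.log_nonneg (by linarith)
  have h5 : (C / 2) ^ θ ≤ ε ^ p * Real.log S * S ^ θ := by
    calc (C / 2) ^ θ = (ε ^ p * σ ^ θ * Real.log (1 + σ)) * (C / 2) ^ θ := by
          rw [hσe, one_mul]
      _ = ε ^ p * Real.log (1 + σ) * ((C / 2) ^ θ * σ ^ θ) := by ring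
      _ ≤ ε ^ p * Real.log S * S ^ θ := by gcongr
  linarith

/-! ### The exponents -/

/-- For `ν > 1`, `p_S(ν)` is the larger root of the concave quadratic `γ_S(·, ν)`, and `p > 1` lies
above the smaller one. Completing the square gives `4(ν-1) γ_S = w² - (2(ν-1)p - (ν+1))²`. -/
lemma gammaS_pos_of_lt_straussExp {p ν : ℝ} (hν : 1 ≤ ν) (hp : 1 < p)
    (h : (p : EReal) < straussExp ν) : 0 < gammaS p ν := by
  rcases hν.eq_or_lt with rfl | hν
  · simp only [gammaS]; linarith
  · rw [straussExp, if_pos hν, EReal.coe_lt_coe_iff, lt_div_iff₀ (by linarith)] at h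
    have hD : 0 ≤ ν ^ 2 + 10 * ν - 7 := by nlinarith
    have hs := Real.sq_sqrt hD
    have hs0 := Real.sqrt_nonneg (ν ^ 2 + 10 * ν - 7)
    set w := Real.sqrt (ν ^ 2 + 10 * ν - 7)
    have h1 : -w < 2 * (ν - 1) * p - (ν + 1) := by
      have : -w ≤ ν - 3 := by
        by_contra! hc
        nlinarith
      nlinarith
    have h2 : 2 * (ν - 1) * p - (ν + 1) < w := by linarith
    have h3 : (2 * (ν - 1) * p - (ν + 1)) ^ 2 < w ^ 2 := sq_lt_sq' h1 h2
    rw [hs] at h3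
    have h4 : 0 < 4 * (ν - 1) * gammaS p ν := by simp only [gammaS]; linarith
    exact pos_of_mul_pos_right h4 (by linarith)

lemma mul_sub_one_lt_of_lt_fujitaExp {p ν : ℝ} (hp : 1 < p) (h : (p : EReal) < fujitaExp ν) :
    ν * (p - 1) < 2 := by
  by_cases hν : 0 < ν
  · rw [fujitaExp, if_pos hν, EReal.coe_lt_coe_iff] at h
    have : p - 1 < 2 / ν := by linarith
    rw [lt_div_iff₀ hν] at this
    linarith
  · nlinarith

lemma one_le_muStar (n : ℕ) : 1 ≤ muStar n := by
  rw [muStar, le_div_iff₀ (by positivity)]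
  have : (0 : ℝ) ≤ n ^ 2 := by positivity
  linarith

/-- Up to `μ_*` the Fujita part of the critical exponent adds nothing. For `μ ≤ 1` this follows from
`γ_S = 2 + 2p - (n+μ-1)p(p-1)`. For `μ ≥ 1` the condition `μ ≤ μ_*` reads `(n+2)(n+μ-1) ≤ 2n(n+1)`.
-/
lemma gammaS_pos {n : ℕ} (hn : 1 ≤ n) {μ p : ℝ} (hμ : 0 ≤ μ) (hp : 1 < p)
    (h : (p : EReal) < critExp n μ) (hμs : μ ≤ muStar n) : 0 < gammaS p (n + μ) := by
  have hn' : (1 : ℝ) ≤ n := by exact_mod_cast hn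
  rcases lt_max_iff.1 h with h | h
  · have h1 := mul_sub_one_lt_of_lt_fujitaExp hp h
    rcases le_total μ 1 with h2 | h2
    · rw [negPart_eq_neg.2 (by linarith)] at h1
      simp only [gammaS]
      nlinarith
    · rw [negPart_eq_zero.2 (by linarith), sub_zero] at h1
      rw [muStar, le_div_iff₀ (by positivity)] at hμs
      obtain ⟨q, rfl⟩ : ∃ q, p = 1 + q := ⟨p - 1, by ring⟩
      have hq : 0 < q := by linarith
      have hnq : n * q < 2 := by linarith
      have e : gammaS (1 + q) (n + μ) = 4 + 2 * q - (n + μ - 1) * q * (1 + q) := by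
        simp only [gammaS]; ring
      rw [e]
      have h3 : (n + 2) * ((n + μ - 1) * q * (1 + q)) ≤ (2 * n * (n + 1)) * q * (1 + q) := by
        have : (n + 2) * (n + μ - 1) ≤ 2 * (n : ℝ) * (n + 1) := by linarith
        calc _ = (n + 2) * (n + μ - 1) * (q * (1 + q)) := by ring
          _ ≤ 2 * (n : ℝ) * (n + 1) * (q * (1 + q)) := by gcongr
          _ = _ := by ring
      have h4 : (2 * (n : ℝ) * (n + 1)) * q * (1 + q) < (n + 2) * (4 + 2 * q) := by
        have a1 : n * q * n < 2 * n := by gcongr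
        have a2 : n * q * q < 2 * q := by gcongr
        have a3 : n * q * (n * q) < 2 * 2 := by gcongr
        linarith
      have h5 : (0 : ℝ) < n + 2 := by linarith
      by_contra! hc
      nlinarith
  · exact gammaS_pos_of_lt_straussExp (by linarith) hp h

lemma gammaS_eq (p ν : ℝ) :
    gammaS p ν = 4 + (3 - ν) * (p - 1) - (ν - 1) * (p - 1) * (p - 1) := by
  simp only [gammaS]; ring

/-- Cleared of denominators, `μ > μ_*` is exactly `p_* < p_F(n)`. -/
lemma natCast_mul_pStar_sub_one_lt {n : ℕ} (hn : 1 ≤ n) {μ : ℝ} (h : muStar n < μ) :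
    n * (pStar n μ - 1) < 2 := by
  have hn' : (1 : ℝ) ≤ n := by exact_mod_cast hn
  have h1 := (one_le_muStar n).trans_lt h
  rw [muStar, div_lt_iff₀ (by positivity)] at h
  rw [pStar, add_sub_cancel_left, mul_div_assoc', div_lt_iff₀ (by linarith)]
  linarith

/-- Below `p_*` one has `γ_S(p,n+μ) > 2γ_F(p,n)`, and the right side is positive because `p < p_* <
p_F(n)`. -/
lemma gammaS_pos_of_lt_pStar {n : ℕ} (hn : 1 ≤ n) {μ p : ℝ} (hp : 1 < p) (h : muStar n < μ)
    (hps : p < pStar n μ) : 0 < gammaS p (n + μ) := by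
  have hn' : (1 : ℝ) ≤ n := by exact_mod_cast hn
  have h1 := one_le_muStar n
  have h2 := natCast_mul_pStar_sub_one_lt hn h
  have h3 : (n + μ - 1) * (p - 1) < n - μ + 3 := by
    rw [pStar] at hps
    have : p - 1 < (n - μ + 3) / (n + μ - 1) := by linarith
    rw [lt_div_iff₀ (by linarith)] at this
    linarith
  have h4 : n * (p - 1) < 2 := by nlinarith
  rw [gammaS_eq]
  nlinarith [mul_lt_mul_of_pos_right h3 (by linarith : 0 < p - 1)]

/-- Above `p_*` one has `2γ_F(p,n) > γ_S(p,n+μ)`, so either branch of the maximum defining the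
critical exponent gives positivity. -/
lemma gammaF_pos {n : ℕ} (hn : 1 ≤ n) {μ p : ℝ} (hp : 1 < p) (hμ1 : 1 ≤ μ)
    (h : (p : EReal) < critExp n μ) (h3 : n - μ + 3 < (n + μ - 1) * (p - 1)) :
    0 < gammaF p n := by
  have hn' : (1 : ℝ) ≤ n := by exact_mod_cast hn
  rcases lt_max_iff.1 h with h | h
  · have h1 := mul_sub_one_lt_of_lt_fujitaExp hp h
    rw [negPart_eq_zero.2 (by linarith), sub_zero] at h1
    simp only [gammaF]; linarith
  · have h1 := gammaS_pos_of_lt_straussExp (by linarith) hp h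
    rw [gammaS_eq] at h1
    simp only [gammaF]
    nlinarith [mul_lt_mul_of_pos_right h3 (by linarith : 0 < p - 1)]

end DampedWave

/-! ### Assembly of the lifespan bounds -/

theorem theorem1p4 (n : ℕ) (hn : 1 ≤ n) (μ p R : ℝ) (hμ : 0 ≤ μ)
    (hp : 1 < p) (hp' : (p : EReal) < DampedWave.critExp n μ) (hR : 1 ≤ R)
    (f g : DampedWave.Space n → ℝ) (hf : DampedWave.MemH1 f) (hg : MemLp g 2 volume)
    (hf_nonneg : ∀ᵐ x, 0 ≤ f x) (hf_ne : ¬ ∀ᵐ x, f x = 0)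
    (hfg : ∀ᵐ x, (μ - 1)⁺ * f x + g x = 0) :
    ∃ ε₃ : ℝ, 0 < ε₃ ∧ ∃ C : ℝ, 0 < C ∧ ∀ ε : ℝ, 0 < ε → ε ≤ ε₃ →
      (μ ≤ DampedWave.muStar n →
        DampedWave.lifespan μ p R f g ε ≤
          ENNReal.ofReal (C * ε ^ (-(2 * p * (p - 1) / DampedWave.gammaS p (n + μ))))) ∧
      (DampedWave.muStar n < μ → μ < n + 3 →
        (p < DampedWave.pStar n μ →
          DampedWave.lifespan μ p R f g ε ≤
            ENNReal.ofReal (C * ε ^ (-(2 * p * (p - 1) / DampedWave.gammaS p (n + μ))))) ∧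
        (p = DampedWave.pStar n μ →
          ∃ σ₀ : ℝ, DampedWave.IsSigmaZero n p ε σ₀ ∧
            (∀ s : ℝ, DampedWave.IsSigmaZero n p ε s → s = σ₀) ∧
            DampedWave.lifespan μ p R f g ε ≤ ENNReal.ofReal (C * σ₀)) ∧
        (DampedWave.pStar n μ < p →
          DampedWave.lifespan μ p R f g ε ≤
            ENNReal.ofReal (C * ε ^ (-(p * (p - 1) / DampedWave.gammaF p n))))) ∧
      (n + 3 ≤ μ →
        DampedWave.lifespan μ p R f g ε ≤
          ENNReal.ofReal (C * ε ^ (-(p * (p - 1) / DampedWave.gammaF p n)))) ∧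
      (n = 1 → 0 < μ → μ < 2 → p < 2 / (1 + |μ - 1|) →
        DampedWave.lifespan μ p R f g ε ≤
          ENNReal.ofReal (C * ε ^ (-((p - 1) / DampedWave.gammaF p (1 + (μ - 1)⁺))))) := by
  open DampedWave in
  have hn' : (1 : ℝ) ≤ n := by exact_mod_cast hn
  have hp0 : 0 < p := by linarith
  obtain ⟨m, hmdef⟩ : ∃ m, m = (μ - 1)⁺ := ⟨_, rfl⟩
  rw [← hmdef] at hfg ⊢
  have hm0 : 0 ≤ m := hmdef ▸ posPart_nonneg _
  have hm1 : 1 ≤ μ → m = μ - 1 := fun h => by rw [hmdef, posPart_eq_self.2 (by linarith)]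
  have hm2 : μ ≤ 1 → m = 0 := fun h => by rw [hmdef, posPart_eq_zero.2 (by linarith)]
  have hm : m * (m + 1 - μ) = 0 := by
    rcases le_total 1 μ with h | h
    · rw [hm1 h]; ring
    · rw [hm2 h]; ring
  obtain ⟨I, c₀, c₁, hI, hc₀, hc₁, H⟩ :=
    exists_massODE hn hp hR hm hf.1 hf_nonneg hf_ne hfg
  -- The exponent produced by `exists_lifespan_le` is `γ = γ_S/2`, whence the factor `2` in the
  -- rate.
  have strauss : 0 < gammaS p (n + μ) → ∃ C : ℝ, 0 < C ∧ ∀ ε : ℝ, 0 < ε → ε ≤ 1 →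
      lifespan μ p R f g ε ≤
        ENNReal.ofReal (C * ε ^ (-(2 * p * (p - 1) / gammaS p (n + μ)))) := by
    intro hγ
    obtain ⟨c, hc, hlow⟩ := MassODE.exists_power_lower n p I c₀ hμ hm hc₁
    have := exists_lifespan_le hμ hp hm hI hc₀ H hc hp0
      (α := (n : ℝ) + 1 - (n + μ - 1) * p / 2) (γ := gammaS p (n + μ) / 2)
      (by simp only [gammaS]; ring) (by linarith) (fun ε b Y Z r hε h s hs => by
        have h1 := hlow ε b Y Z r hε h s hs
        have : 0 ≤ ε * I * s ^ (-m) :=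
          mul_nonneg (by positivity) (Real.rpow_nonneg (by linarith [hs.1]) _)
        linarith)
    rwa [show p * (p - 1) / (gammaS p (n + μ) / 2) = 2 * p * (p - 1) / gammaS p (n + μ) by
      field_simp] at this
  have fujita : 0 < gammaF p n → ∃ C : ℝ, 0 < C ∧ ∀ ε : ℝ, 0 < ε → ε ≤ 1 →
      lifespan μ p R f g ε ≤ ENNReal.ofReal (C * ε ^ (-(p * (p - 1) / gammaF p n))) := by
    intro hγ
    obtain ⟨c, hc, hlow⟩ := MassODE.exists_const_lower n p I c₀ hμ hm hI hc₁
    exact exists_lifespan_le hμ hp hm hI hc₀ H hc hp0 (α := 0) (by simp only [gammaF]; ring) hγ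
      (fun ε b Y Z r hε h s hs => by simpa using hlow ε b Y Z r hε h s hs)
  have crit : muStar n < μ → p = pStar n μ → ∃ C : ℝ, 0 < C ∧ ∀ ε : ℝ, 0 < ε → ε ≤ 1 →
      ∃ σ₀ : ℝ, IsSigmaZero n p ε σ₀ ∧ (∀ s : ℝ, IsSigmaZero n p ε s → s = σ₀) ∧
        lifespan μ p R f g ε ≤ ENNReal.ofReal (C * σ₀) := by
    intro h1 h2
    have h3 := one_le_muStar n
    have h4 := natCast_mul_pStar_sub_one_lt hn h1
    have hmμ := hm1 (by linarith)
    refine exists_lifespan_le_log hμ hp (by linarith) (by linarith) hI hc₀ hc₁ H ?_ ?_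
    · have : (n + μ - 1) * p = 2 * n + 2 := by
        rw [h2, pStar]
        have : (n : ℝ) + μ - 1 ≠ 0 := by linarith
        field_simp
        ring
      rw [this]; ring
    · rw [← h2] at h4
      rw [sub_pos, lt_div_iff₀ (by linarith)]
      exact h4
  have line : n = 1 → μ < 2 → p < 2 / (1 + |μ - 1|) → ∃ C : ℝ, 0 < C ∧ ∀ ε : ℝ, 0 < ε → ε ≤ 1 →
      lifespan μ p R f g ε ≤ ENNReal.ofReal (C * ε ^ (-((p - 1) / gammaF p (1 + m)))) := by
    intro hn1 hμ2 hpl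
    have hγ : 0 < gammaF p (1 + m) := by
      rw [lt_div_iff₀ (by positivity)] at hpl
      simp only [gammaF]
      rcases le_total 1 μ with h | h
      · rw [abs_of_nonneg (by linarith)] at hpl
        rw [hm1 h]
        nlinarith
      · rw [hm2 h]
        nlinarith [abs_nonneg (μ - 1)]
    have := exists_lifespan_le hμ hp hm hI hc₀ H hI one_pos (α := -m) (γ := gammaF p (1 + m))
      (by simp only [gammaF, hn1]; push_cast; ring) hγ (fun ε b Y Z r hε h s hs => by
        have := h.linear_lower hμ hm s ⟨by linarith [hs.1], hs.2⟩
        rw [Real.rpow_one, mul_comm I]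
        exact this)
    simpa only [one_mul] using this
  -- The constants must precede `ε` and the case distinction, so a case whose hypothesis fails gets
  -- the dummy constant `1`; the sum of the four constants then serves all cases.
  have uniform : ∀ {P : Prop} {Q : ℝ → ℝ → Prop}, (P → ∃ C : ℝ, 0 < C ∧ ∀ ε, 0 < ε → ε ≤ 1 → Q C ε) →
      ∃ C : ℝ, 0 < C ∧ ∀ ε, 0 < ε → ε ≤ 1 → P → Q C ε := by
    intro P Q h
    by_cases hP : P
    · obtain ⟨C, hC, hQ⟩ := h hP
      exact ⟨C, hC, fun ε h1 h2 _ => hQ ε h1 h2⟩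
    · exact ⟨1, one_pos, fun _ _ _ h => absurd h hP⟩
  obtain ⟨C₁, hC₁, H₁⟩ := uniform strauss
  obtain ⟨C₂, hC₂, H₂⟩ := uniform fujita
  obtain ⟨C₃, hC₃, H₃⟩ := uniform (P := muStar n < μ ∧ p = pStar n μ) fun h => crit h.1 h.2
  obtain ⟨C₄, hC₄, H₄⟩ := uniform (P := n = 1 ∧ μ < 2 ∧ p < 2 / (1 + |μ - 1|))
    fun h => line h.1 h.2.1 h.2.2
  have le_of_le : ∀ {c x : ℝ} {L : ℝ≥0∞}, 0 ≤ x → c ≤ C₁ + C₂ + C₃ + C₄ →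
      L ≤ ENNReal.ofReal (c * x) → L ≤ ENNReal.ofReal ((C₁ + C₂ + C₃ + C₄) * x) :=
    fun hx hc hL => hL.trans (ENNReal.ofReal_le_ofReal (mul_le_mul_of_nonneg_right hc hx))
  have hpow : ∀ {ε : ℝ}, 0 < ε → ∀ x : ℝ, 0 ≤ ε ^ x := fun h x => Real.rpow_nonneg h.le x
  refine ⟨1, one_pos, C₁ + C₂ + C₃ + C₄, by positivity, fun ε hε hε1 =>
    ⟨fun h1 => ?_, fun h1 h2 => ⟨fun h3 => ?_, fun h3 => ?_, fun h3 => ?_⟩, fun h1 => ?_,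
      fun h1 h2 h3 h4 => ?_⟩⟩
  · exact le_of_le (hpow hε _) (by linarith) (H₁ ε hε hε1 (gammaS_pos hn hμ hp hp' h1))
  · exact le_of_le (hpow hε _) (by linarith) (H₁ ε hε hε1 (gammaS_pos_of_lt_pStar hn hp h1 h3))
  · obtain ⟨σ, hσ, hu, hL⟩ := H₃ ε hε hε1 ⟨h1, h3⟩
    exact ⟨σ, hσ, hu, le_of_le hσ.1.le (by linarith) hL⟩
  · have h4 := one_le_muStar n
    refine le_of_le (hpow hε _) (by linarith)
      (H₂ ε hε hε1 (gammaF_pos hn hp (by linarith) hp' ?_))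
    rw [pStar] at h3
    have : (n - μ + 3) / (n + μ - 1) < p - 1 := by linarith
    rw [div_lt_iff₀ (by linarith)] at this
    linarith
  · refine le_of_le (hpow hε _) (by linarith)
      (H₂ ε hε hε1 (gammaF_pos hn hp (by linarith) hp' ?_))
    have : 0 < (n + μ - 1) * (p - 1) := mul_pos (by linarith) (by linarith)
    linarith
  · exact le_of_le (hpow hε _) (by linarith) (H₄ ε hε hε1 ⟨h1, h3, h4⟩)
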